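/- Let $(X,d)$ be a complete metric space which is doubling (for some $N$, every closed ball $B(y,\rho)=\{z: d(y,z)\le\rho\}$, $\rho>0$, is covered by $N$ closed balls of radius $\rho/2$). Let $m\in\mathbb N$, $\Sigma=\{1,\dots,m\}^{\mathbb N}$, $\Sigma_n=\{1,\dots,m\}^n$, $\Sigma_*=\{\varnothing\}\cup\bigcup_{n\ge1}\Sigma_n$. For $\mathtt i=(i_1,i_2,\dots)$ put $\mathtt i|_n=(i_1,\dots,i_n)$. Let $\{E_{\mathtt i}:\mathtt i\in\Sigma_*\}$ be compact subsets of $X$ such that, for some constants $0<C_0,C_1<\infty$, (M1) $E_{\mathtt i i}\subset E_{\mathtt i}$ for all $\mathtt i\in\Sigma_*$ and $i\in\{1,\dots,m\}$; (M2) $E_{\mathtt i i}\cap E_{\mathtt i j}=\emptyset$ for all $\mathtt i\in\Sigma_*$ and $i\ne j$; (M3) for each $\mathtt i\in\Sigma_*$ there is $x\in E_{\mathtt i}$ with $B(x,C_0\operatorname{diam}E_{\mathtt i})\subset E_{\mathtt i}$; (M4) $\operatorname{diam}(E_{\mathtt i|_n})\to0$ as $n\to\infty$ for each $\mathtt i\in\Sigma$;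 (M5) $\operatorname{diam}(E_{\mathtt i})/\operatorname{diam}(E_{\mathtt i i})\le C_1$ for all $\mathtt i\in\Sigma_*$ and $i\in\{1,\dots,m\}$. Let $E=\bigcap_n\bigcup_{\mathtt i\in\Sigma_n}E_{\mathtt i}$, and for $\mathtt i\in\Sigma$ let $x_{\mathtt i}$ be the point with $\{x_{\mathtt i}\}=\bigcap_nE_{\mathtt i|_n}$. Let $r_1,\dots,r_m:E\to(0,1)$ be continuous, put $r_{\mathtt i}(x)=\prod_{k=1}^nr_{i_k}(x)$ for $\mathtt i\in\Sigma_n$, and assume (M6) $\log\operatorname{diam}(E_{\mathtt i|_n})/\log r_{\mathtt i|_n}(x_{\mathtt i})\to1$ as $n\to\infty$, uniformly in $\mathtt i\in\Sigma$. Let $\mu$ be a Borel probability measure on $X$ with $\operatorname{spt}\mu=E$, and put $p_{\mathtt i}^i=\mu(E_{\mathtt i i})/\mu(E_{\mathtt i})$. Let $p_1,\dots,p_m:E\to(0,1)$ be continuous functions with $\sum_ip_i(x)=1$ for $x\in E$, bounded below by a constant $a>0$, and suppose that for each $i$, $p^i_{\mathtt i|_n}\to p_i(x_{\mathtt i})$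 as $n\to\infty$, uniformly in $\mathtt i\in\Sigma$. For $x\in E$ define the local $L^q$-spectrum $$\tau_q(\mu,x)=\lim_{r\downarrow0}\liminf_{\delta\downarrow0}\frac{\log S^*_{q,\delta,r}(\mu,x)}{\log\delta},\qquad S^*_{q,\delta,r}(\mu,x)=\sup_{\mathcal B}\sum_{B\in\mathcal B}\mu(B)^q,$$ where the supremum is over all countable families $\mathcal B$ of pairwise disjoint closed balls of radius $\delta$ with centres in $B(x,r)\cap\operatorname{spt}\mu$. Define the upper entropy dimension of $\mu$ at $x$ by $$\overline{\dim}_1(\mu,x)=\limsup_{r\downarrow0}\limsup_{\delta\downarrow0}\frac{1}{\log\delta}\,\frac1{\mu(B(x,r))}\int_{B(x,r)}\log\mu(B(y,\delta))\,d\mu(y),$$ and the lower one $\underline{\dim}_1(\mu,x)$ with both $\limsup$ replaced by $\liminf$; $\dim_1(\mu,x)$ is their common value if they coincide. Let $\dim_{\rm loc}(\mu,x)=\lim_{r\downarrow0}\log\mu(B(x,r))/\log r$, if the limit exists. Then for all $x\in E$ and all $q\ge0$, $\tau_q(\mu,x)$ is the unique $\tau\in\mathbb R$ that satisfies $$\sum_{i=1}^mp_i(x)^q\,r_i(x)^{-\tau}=1.$$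 Moreover, for $\mu$-almost every $x\in E$, both $\dim_1(\mu,x)$ and $\dim_{\rm loc}(\mu,x)$ exist and $$\dim_1(\mu,x)=\dim_{\rm loc}(\mu,x)=\frac{\sum_{i=1}^mp_i(x)\log p_i(x)}{\sum_{i=1}^mp_i(x)\log r_i(x)}.$$ -/

import Mathlib

open MeasureTheory Filter Topology Set
open scoped ENNReal

noncomputable section

namespace LocalDim

/-! ### Doubling spaces and packings -/

/-- A metric space is doubling if for some `N` every closed ball of positive radius is covered by
at most `N` closed balls of half the radius. -/
def IsDoubling (X : Type*) [MetricSpace X] : Prop :=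
  ∃ N : ℕ, ∀ (x : X) (r : ℝ), 0 < r →
    ∃ s : Finset X, s.card ≤ N ∧ Metric.closedBall x r ⊆ ⋃ y ∈ s, Metric.closedBall y (r / 2)

variable {X : Type*} [MetricSpace X]

/-- `C` is the set of centres of a `δ`-packing of `A`: a countable family of pairwise disjoint
closed balls of radius `δ` with centres in `A`. -/
def IsPacking (δ : ℝ) (A C : Set X) : Prop :=
  C ⊆ A ∧ C.Countable ∧ C.PairwiseDisjoint (fun c => Metric.closedBall c δ)

variable [MeasurableSpace X]

/-! ### The local `L^q`-spectrum -/

/-- The supremum of `∑ μ(B)^q` over all `δ`-packings of `B(x,r) ∩ spt μ`. -/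
def packingSum (μ : Measure X) (q δ r : ℝ) (x : X) : ℝ≥0∞ :=
  ⨆ (C : Set X) (_ : IsPacking δ (Metric.closedBall x r ∩ μ.support) C),
    ∑' c : C, μ (Metric.closedBall (c : X) δ) ^ q

/-- The lower exponent, as `δ ↓ 0`, of `packingSum` at a fixed scale `r`. -/
def packingExponent (μ : Measure X) (q : ℝ) (x : X) (r : ℝ) : EReal :=
  liminf (fun δ : ℝ => ENNReal.log (packingSum μ q δ r x) / ((Real.log δ : ℝ) : EReal)) (𝓝[>] 0)

/-- The local `L^q`-spectrum `τ_q(μ,x) = lim_{r ↓ 0} liminf_{δ ↓ 0} log S / log δ`. The limit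
always exists in the extended reals, see `tendsto_lqSpectrum`. -/
def lqSpectrum (μ : Measure X) (q : ℝ) (x : X) : EReal :=
  limUnder (𝓝[>] (0 : ℝ)) (packingExponent μ q x)

theorem packingSum_mono (μ : Measure X) (q δ : ℝ) (x : X) :
    Monotone fun r => packingSum μ q δ r x := by
  intro r₁ r₂ h
  refine iSup_mono fun C => iSup_mono' fun hC => ⟨⟨hC.1.trans ?_, hC.2⟩, le_rfl⟩
  exact inter_subset_inter_left _ (Metric.closedBall_subset_closedBall h)

theorem packingExponent_antitone (μ : Measure X) (q : ℝ) (x : X) :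
    Antitone (packingExponent μ q x) := by
  intro r₁ r₂ h
  refine liminf_le_liminf ?_
  have h1 : ∀ᶠ δ : ℝ in 𝓝[>] 0, δ ∈ Ioo (0 : ℝ) 1 := Ioo_mem_nhdsGT one_pos
  filter_upwards [h1] with δ hδ
  refine EReal.div_le_div_right_of_nonpos ?_ ?_
  · exact_mod_cast (Real.log_neg hδ.1 hδ.2).le
  · exact ENNReal.log_monotone (packingSum_mono μ q δ x h)

theorem tendsto_lqSpectrum (μ : Measure X) (q : ℝ) (x : X) :
    Tendsto (packingExponent μ q x) (𝓝[>] (0 : ℝ)) (𝓝 (lqSpectrum μ q x)) :=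
  tendsto_nhds_limUnder ⟨_, (packingExponent_antitone μ q x).tendsto_nhdsGT 0⟩

/-! ### Local dimensions and entropy dimensions -/

/-- The upper local dimension of `μ` at `x`. -/
def upperLocalDim (μ : Measure X) (x : X) : EReal :=
  limsup (fun r : ℝ => ENNReal.log (μ (Metric.closedBall x r)) / ((Real.log r : ℝ) : EReal))
    (𝓝[>] 0)

/-- The lower local dimension of `μ` at `x`. -/
def lowerLocalDim (μ : Measure X) (x : X) : EReal :=
  liminf (fun r : ℝ => ENNReal.log (μ (Metric.closedBall x r)) / ((Real.log r : ℝ) : EReal))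
    (𝓝[>] 0)

/-- The local dimension of `μ` at `x` exists and equals `s`. -/
def HasLocalDim (μ : Measure X) (x : X) (s : EReal) : Prop :=
  lowerLocalDim μ x = s ∧ upperLocalDim μ x = s

/-- The quotient of the mean of `y ↦ log μ(B(y,δ))` over `B(x,r)` by `log δ`. -/
def entropyQuotient (μ : Measure X) (x : X) (r δ : ℝ) : ℝ :=
  (⨍ y in Metric.closedBall x r, Real.log (μ.real (Metric.closedBall y δ)) ∂μ) / Real.log δ

/-- The upper entropy dimension of `μ` at `x`. -/
def upperEntropyDim (μ : Measure X) (x : X) : EReal :=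
  limsup (fun r : ℝ => limsup (fun δ : ℝ => (entropyQuotient μ x r δ : EReal)) (𝓝[>] 0)) (𝓝[>] 0)

/-- The lower entropy dimension of `μ` at `x`. -/
def lowerEntropyDim (μ : Measure X) (x : X) : EReal :=
  liminf (fun r : ℝ => liminf (fun δ : ℝ => (entropyQuotient μ x r δ : EReal)) (𝓝[>] 0)) (𝓝[>] 0)

/-- The entropy dimension `dim_1(μ,x)` exists and equals `s`. -/
def HasEntropyDim (μ : Measure X) (x : X) (s : EReal) : Prop :=
  lowerEntropyDim μ x = s ∧ upperEntropyDim μ x = s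

/-! ### Moran constructions

Finite words over the alphabet `{1, …, m}` are lists over `Fin m`, infinite words are functions
`ℕ → Fin m`. -/

/-- The prefix of length `n` of an infinite word. -/
def pref {m : ℕ} (i : ℕ → Fin m) (n : ℕ) : List (Fin m) := List.ofFn fun k : Fin n => i k

/-- The limit set `⋂ n, ⋃ |w| = n, E_w`. -/
def limitSet {X : Type*} {m : ℕ} (E : List (Fin m) → Set X) : Set X :=
  ⋂ n : ℕ, ⋃ w ∈ {w : List (Fin m) | w.length = n}, E w

/-- The pairs `(i, x)` with `x ∈ ⋂ n, E_{i|n}`. For a Moran construction each of these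
intersections is a singleton, so that this is the graph of `i ↦ x_i`. -/
def coding {X : Type*} {m : ℕ} (E : List (Fin m) → Set X) : Set ((ℕ → Fin m) × X) :=
  {z | z.2 ∈ ⋂ n : ℕ, E (pref z.1 n)}

/-- The product `r_w(x)` of the values `r_i(x)` over the letters `i` of the word `w`. -/
def wordProd {X : Type*} {m : ℕ} (r : Fin m → X → ℝ) (w : List (Fin m)) (x : X) : ℝ :=
  (w.map fun i => r i x).prod

/-- A Moran construction: compact sets `E_w` indexed by finite words, and ratio functions
`r_1, …, r_m`. Only the values of the `r_i` on the limit set matter. -/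
structure IsMoranConstruction {X : Type*} [MetricSpace X] {m : ℕ}
    (E : List (Fin m) → Set X) (r : Fin m → X → ℝ) : Prop where
  isCompact : ∀ w, IsCompact (E w)
  nested : ∀ w i, E (w ++ [i]) ⊆ E w
  disjoint : ∀ w i j, i ≠ j → Disjoint (E (w ++ [i])) (E (w ++ [j]))
  inner_ball : ∃ C₀ : ℝ, 0 < C₀ ∧
    ∀ w, ∃ x ∈ E w, Metric.closedBall x (C₀ * Metric.diam (E w)) ⊆ E w
  diam_tendsto : ∀ i : ℕ → Fin m, Tendsto (fun n => Metric.diam (E (pref i n))) atTop (𝓝 0)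
  diam_ratio : ∃ C₁ : ℝ, 0 < C₁ ∧
    ∀ w i, Metric.diam (E w) / Metric.diam (E (w ++ [i])) ≤ C₁
  ratio_continuous : ∀ i, ContinuousOn (r i) (limitSet E)
  ratio_mem : ∀ i, ∀ x ∈ limitSet E, r i x ∈ Ioo (0 : ℝ) 1
  diam_asymp : TendstoUniformlyOn
    (fun n (z : (ℕ → Fin m) × X) =>
      Real.log (Metric.diam (E (pref z.1 n))) / Real.log (wordProd r (pref z.1 n) z.2))
    (fun _ => (1 : ℝ)) atTop (coding E)

/-- The weight `p_w^i`, determined by `μ(E_{wi}) = p_w^i μ(E_w)`. -/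
def weight (μ : Measure X) {m : ℕ} (E : List (Fin m) → Set X) (w : List (Fin m)) (i : Fin m) : ℝ :=
  μ.real (E (w ++ [i])) / μ.real (E w)

end LocalDim

end

/-! Near a point `x` of the limit set everything is governed by the values `p_i(x)`, `r_i(x)`:
by continuity, the diameter condition and the convergence of the weights, words `w` that extend a
long prefix of the code of `x` satisfy `log diam E_w = ∑ log r_i(x) + o(|w|)` and
`log μ(E_w) = ∑ log p_i(x) + o(|w|)`, the sums being over the letters `i` of `w`
(`IsMoranConstruction.exists_abs_log_diam_sub_sum_le`,
`HasLimitWeights.exists_abs_log_measureReal_sub_sum_le`).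

Geometry enters through cuts of the tree of words at a scale `δ` (`IsCut`). The sets `E_w` of a cut
are disjoint, have diameter comparable to `δ`, and contain balls of comparable radius, so in a
doubling space a ball of radius comparable to `δ` meets a bounded number of them
(`IsMoranConstruction.exists_card_overlap_le`).

For the `L^q`-spectrum, packing sums at scale `δ` are therefore comparable to `∑ μ(E_w)^q` over a
cut. If `τ` solves `∑ p_i^q r_i^{-τ} = 1` at `x`, the products of the numbers `p_i^q r_i^{-τ}` along
words have the same sum over every cut below a fixed word, and since the diameters on the cut are
about `δ` this makes `∑ μ(E_w)^q` equal to `δ^τ` up to a small power of `δ`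
(`HasLimitWeights.exists_abs_log_sum_sub_le`, `HasLimitWeights.lqSpectrum_eq`).

For the local dimension, an exponential moment bound for the number of occurrences of a letter,
compensated by the weights, shows that almost every code has letter frequencies `p_i` at the coded
point (`HasLimitWeights.ae_tendsto_count_div`). This gives the growth rates of `μ(E_w)` and
`diam E_w` along the code. A ball around `x` contains the construction set of `x` at its scale; it
has not much more mass for almost every `x`, by the overlap bound and the Borel–Cantelli lemma
(`HasLimitWeights.ae_exists_log_closedBall_le`). Finally the quotients
`log μ(B(y,δ)) / log δ` are uniformly bounded on the limit set, so the entropy dimension is obtained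
from the local dimension by dominated convergence and continuity, at every point of the limit set
(`HasLimitWeights.hasEntropyDim`). -/

noncomputable section

namespace LocalDim

/-! ### Doubling spaces -/

section Doubling

variable {X : Type*} [MetricSpace X]

theorem IsDoubling.exists_cover (hX : IsDoubling X) (k : ℕ) :
    ∃ M : ℕ, ∀ (x : X) (ρ : ℝ), 0 < ρ → ∃ s : Finset X, s.card ≤ M ∧
      Metric.closedBall x ρ ⊆ ⋃ y ∈ s, Metric.closedBall y (ρ / 2 ^ k) := by
  classical
  obtain ⟨N, hN⟩ := hX
  induction k with
  | zero => exact ⟨1, fun x ρ _ => ⟨{x}, by simp, by simp⟩⟩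
  | succ k ih =>
    obtain ⟨M, hM⟩ := ih
    refine ⟨M * N, fun x ρ hρ => ?_⟩
    obtain ⟨s, hs, hcov⟩ := hM x ρ hρ
    choose t ht htcov using fun y => hN y (ρ / 2 ^ k) (by positivity)
    refine ⟨s.biUnion t, ?_, ?_⟩
    · exact (Finset.card_biUnion_le_card_mul _ _ _ fun y _ => ht y).trans
        (Nat.mul_le_mul_right _ hs)
    · intro z hz
      obtain ⟨y, hy, hzy⟩ := mem_iUnion₂.1 (hcov hz)
      obtain ⟨y', hy', hz'⟩ := mem_iUnion₂.1 (htcov y hzy)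
      exact mem_iUnion₂.2 ⟨y', Finset.mem_biUnion.2 ⟨y, hy, hy'⟩, by rwa [pow_succ, ← div_div]⟩

theorem IsDoubling.properSpace [CompleteSpace X] (hX : IsDoubling X) : ProperSpace X := by
  refine ProperSpace.of_isCompact_closedBall_of_le 1 fun x ρ hρ => ?_
  refine TotallyBounded.isCompact_of_isClosed (Metric.totallyBounded_iff.2 fun ε hε => ?_)
    Metric.isClosed_closedBall
  have hρ0 : 0 < ρ := by linarith
  obtain ⟨k, hk⟩ := exists_pow_lt_of_lt_one (div_pos hε hρ0) (one_half_lt_one (α := ℝ))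
  obtain ⟨M, hM⟩ := hX.exists_cover k
  obtain ⟨s, -, hs⟩ := hM x ρ hρ0
  refine ⟨s, s.finite_toSet, hs.trans (iUnion₂_mono fun y _ =>
    Metric.closedBall_subset_ball ?_)⟩
  rw [lt_div_iff₀ hρ0] at hk
  calc ρ / 2 ^ k = (1 / 2) ^ k * ρ := by rw [one_div, inv_pow]; ring
    _ < ε := hk

/-- In a doubling space a ball of radius `ρ` holds a bounded number of `ηρ`-separated points. -/
theorem IsDoubling.exists_card_le (hX : IsDoubling X) {η : ℝ} (hη : 0 < η) :
    ∃ M : ℕ, ∀ {ι : Type*} (T : Finset ι) (f : ι → X) (y : X) (ρ : ℝ), 0 < ρ →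
      (∀ t ∈ T, dist (f t) y ≤ ρ) →
      (∀ t ∈ T, ∀ t' ∈ T, t ≠ t' → η * ρ < dist (f t) (f t')) → T.card ≤ M := by
  obtain ⟨k, hk⟩ := exists_pow_lt_of_lt_one (half_pos hη) (one_half_lt_one (α := ℝ))
  obtain ⟨M, hM⟩ := hX.exists_cover k
  refine ⟨M, fun {ι} T f y ρ hρ hy hsep => ?_⟩
  obtain ⟨s, hs, hcov⟩ := hM y ρ hρ
  have h1 : ∀ t : ι, ∃ c, t ∈ T → c ∈ s ∧ dist (f t) c ≤ ρ / 2 ^ k := fun t => by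
    by_cases ht : t ∈ T
    · obtain ⟨c, hc, hc'⟩ := mem_iUnion₂.1 (hcov (hy t ht))
      exact ⟨c, fun _ => ⟨hc, hc'⟩⟩
    · exact ⟨y, fun h => absurd h ht⟩
  choose g hg using h1
  refine (Finset.card_le_card_of_injOn g (fun t ht => (hg t ht).1) ?_).trans hs
  intro t ht t' ht' htt'
  by_contra hne
  have h2 := hsep t ht t' ht' hne
  have h3 := dist_triangle_right (f t) (f t') (g t)
  have h4 := (hg t ht).2
  have h5 := (hg t' ht').2
  rw [← htt'] at h5
  have h6 : ρ / 2 ^ k = (1 / 2) ^ k * ρ := by rw [one_div, inv_pow]; ring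
  have h7 := mul_lt_mul_of_pos_right hk hρ
  linarith

end Doubling

/-! ### Words and codes -/

section Words

variable {m : ℕ}

@[simp] theorem length_pref (i : ℕ → Fin m) (n : ℕ) : (pref i n).length = n := by simp [pref]

theorem pref_succ (i : ℕ → Fin m) (n : ℕ) : pref i (n + 1) = pref i n ++ [i n] := by
  rw [pref, List.ofFn_succ_last]
  rfl

theorem pref_prefix (i : ℕ → Fin m) {k n : ℕ} (h : k ≤ n) : pref i k <+: pref i n := by
  induction n, h using Nat.le_induction with
  | base => exact List.prefix_rfl
  | succ n _ ih => exact ih.trans (by rw [pref_succ]; exact List.prefix_append _ _)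

theorem exists_pref_eq [Nonempty (Fin m)] (w : List (Fin m)) :
    ∃ i : ℕ → Fin m, pref i w.length = w := by
  refine ⟨fun k => w.getD k (Classical.arbitrary _), List.ext_getElem (by simp) fun k h1 h2 => ?_⟩
  simp [pref]

theorem abs_sum_map_sub_le {g h : Fin m → ℝ} {ε : ℝ} (H : ∀ i, |g i - h i| ≤ ε)
    (w : List (Fin m)) : |(w.map g).sum - (w.map h).sum| ≤ ε * w.length := by
  induction w with
  | nil => simp
  | cons a w ih =>
    have h1 : ((a :: w).map g).sum - ((a :: w).map h).sum
        = (g a - h a) + ((w.map g).sum - (w.map h).sum) := by simp; ring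
    rw [h1]
    refine (abs_add_le _ _).trans ?_
    have := H a
    push_cast [List.length_cons]
    linarith

theorem sum_map_le {g : Fin m → ℝ} {C : ℝ} (H : ∀ i, g i ≤ C) (w : List (Fin m)) :
    (w.map g).sum ≤ C * w.length := by
  induction w with
  | nil => simp
  | cons a w ih =>
    have := H a
    simp only [List.map_cons, List.sum_cons, List.length_cons]
    push_cast
    linarith

theorem sum_map_eq_sum_count (g : Fin m → ℝ) (w : List (Fin m)) :
    (w.map g).sum = ∑ j, w.count j * g j := by
  induction w with
  | nil => simp
  | cons a w ih =>
    simp only [List.map_cons, List.sum_cons, ih, List.count_cons, beq_iff_eq, Nat.cast_add,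
      Nat.cast_ite, Nat.cast_one, Nat.cast_zero, add_mul, Finset.sum_add_distrib, ite_mul, one_mul,
      zero_mul, Finset.sum_ite_eq, Finset.mem_univ, if_true]
    ring

theorem log_wordProd {X : Type*} {g : Fin m → X → ℝ} {x : X} (h : ∀ i, 0 < g i x)
    (w : List (Fin m)) :
    Real.log (wordProd g w x) = (w.map fun i => Real.log (g i x)).sum := by
  induction w with
  | nil => simp [wordProd]
  | cons a w ih =>
    have h1 : wordProd g (a :: w) x = g a x * wordProd g w x := by simp [wordProd]
    have h2 : 0 < wordProd g w x := List.prod_pos (by simpa using fun i _ => h i)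
    rw [h1, Real.log_mul (h a).ne' h2.ne', ih]
    simp

end Words

section Codes

variable {X : Type*} {m : ℕ} {E : List (Fin m) → Set X}

theorem mem_coding {i : ℕ → Fin m} {x : X} : (i, x) ∈ coding E ↔ ∀ n, x ∈ E (pref i n) := by
  simp [coding]

theorem mem_limitSet {x : X} :
    x ∈ limitSet E ↔ ∀ n, ∃ w : List (Fin m), w.length = n ∧ x ∈ E w := by
  simp [limitSet]

theorem mem_limitSet_of_mem_coding {z : (ℕ → Fin m) × X} (h : z ∈ coding E) :
    z.2 ∈ limitSet E :=
  mem_limitSet.2 fun n => ⟨pref z.1 n, by simp, mem_coding.1 h n⟩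

variable [Nonempty (Fin m)]

/-- The prefix of length `n` of the code of `x`; meaningful for `x` in the limit set. -/
def word (E : List (Fin m) → Set X) (x : X) (n : ℕ) : List (Fin m) :=
  pref (Classical.epsilon fun i => (i, x) ∈ coding E) n

@[simp] theorem length_word (x : X) (n : ℕ) : (word E x n).length = n := length_pref _ _

theorem word_succ (x : X) (n : ℕ) : ∃ i, word E x (n + 1) = word E x n ++ [i] :=
  ⟨_, pref_succ _ _⟩

theorem word_prefix (x : X) {k n : ℕ} (h : k ≤ n) : word E x k <+: word E x n := pref_prefix _ h

end Codes

section Coding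

variable {X : Type*} [MetricSpace X] {m : ℕ} {E : List (Fin m) → Set X} {r : Fin m → X → ℝ}

theorem IsMoranConstruction.subset_of_prefix (hE : IsMoranConstruction E r) {v w : List (Fin m)}
    (h : v <+: w) : E w ⊆ E v := by
  obtain ⟨u, rfl⟩ := h
  induction u using List.reverseRecOn with
  | nil => simp
  | append_singleton u i ih =>
    rw [← List.append_assoc]
    exact (hE.nested _ _).trans ih

theorem IsMoranConstruction.eq_of_mem (hE : IsMoranConstruction E r) {v w : List (Fin m)} {x : X}
    (h : v.length = w.length) (hv : x ∈ E v) (hw : x ∈ E w) : v = w := by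
  induction v using List.reverseRecOn generalizing w with
  | nil => exact (List.length_eq_zero_iff.1 h.symm).symm
  | append_singleton v i ih =>
    rcases List.eq_nil_or_concat w with rfl | ⟨w, j, rfl⟩
    · simp at h
    · rw [List.concat_eq_append] at h hw ⊢
      have h1 : v = w := ih (by simpa using h) (hE.nested _ _ hv) (hE.nested _ _ hw)
      subst h1
      by_contra hne
      have hij : i ≠ j := fun hij => hne (by rw [hij])
      exact (hE.disjoint v i j hij).le_bot ⟨hv, hw⟩

theorem IsMoranConstruction.prefix_of_mem (hE : IsMoranConstruction E r) {v w : List (Fin m)}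
    {x : X} (h : v.length ≤ w.length) (hv : x ∈ E v) (hw : x ∈ E w) : v <+: w := by
  have h1 : w.take v.length = v := by
    refine hE.eq_of_mem (by simpa using h) ?_ hv
    exact hE.subset_of_prefix (List.take_prefix _ _) hw
  exact h1 ▸ List.take_prefix _ _

theorem IsMoranConstruction.exists_mem_coding (hE : IsMoranConstruction E r) {x : X}
    (hx : x ∈ limitSet E) : ∃ i : ℕ → Fin m, (i, x) ∈ coding E := by
  choose w hw hxw using mem_limitSet.1 hx
  have h1 : ∀ n, n < (w (n + 1)).length := fun n => by rw [hw]; exact n.lt_succ_self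
  refine ⟨fun n => (w (n + 1))[n]'(h1 n), mem_coding.2 fun n => ?_⟩
  suffices h : pref (fun n => (w (n + 1))[n]'(h1 n)) n = w n by rw [h]; exact hxw n
  induction n with
  | zero => rw [List.length_eq_zero_iff.1 (hw 0)]; simp [pref]
  | succ n ih =>
    rw [pref_succ, ih]
    have h2 : w n <+: w (n + 1) :=
      hE.prefix_of_mem (by rw [hw, hw]; exact n.le_succ) (hxw n) (hxw (n + 1))
    obtain ⟨t, ht⟩ := h2
    have h3 : t.length = 1 := by
      have := congrArg List.length ht
      simp only [List.length_append, hw] at this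
      omega
    obtain ⟨a, rfl⟩ := List.length_eq_one_iff.1 h3
    have h4 : (w (n + 1))[n]'(h1 n) = a := by
      have h5 : (w n ++ [a])[n]'(by simp [hw]) = a := by
        rw [List.getElem_append_right (by simp [hw])]; simp
      simp only [← ht, h5]
    rw [h4, ht]

theorem IsMoranConstruction.nonempty (hE : IsMoranConstruction E r) (w : List (Fin m)) :
    (E w).Nonempty := by
  obtain ⟨C, -, h⟩ := hE.inner_ball
  obtain ⟨x, hx, -⟩ := h w
  exact ⟨x, hx⟩

theorem IsMoranConstruction.exists_coding_pref_eq [Nonempty (Fin m)]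
    (hE : IsMoranConstruction E r) (w : List (Fin m)) :
    ∃ z ∈ coding E, pref z.1 w.length = w := by
  obtain ⟨i, hi⟩ := exists_pref_eq w
  obtain ⟨x, hx⟩ := IsCompact.nonempty_iInter_of_sequence_nonempty_isCompact_isClosed
    (fun n => E (pref i n)) (fun n => hE.subset_of_prefix (pref_prefix i n.le_succ))
    (fun n => hE.nonempty _) (hE.isCompact _) fun n => (hE.isCompact _).isClosed
  exact ⟨(i, x), hx, hi⟩

theorem IsMoranConstruction.exists_mem_limitSet [Nonempty (Fin m)]
    (hE : IsMoranConstruction E r) (w : List (Fin m)) : ∃ x ∈ limitSet E, x ∈ E w := by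
  obtain ⟨z, hz, hw⟩ := hE.exists_coding_pref_eq w
  exact ⟨z.2, mem_limitSet_of_mem_coding hz, hw ▸ mem_coding.1 hz _⟩

section Word

variable [Nonempty (Fin m)]

theorem IsMoranConstruction.mem_coding_epsilon (hE : IsMoranConstruction E r) {x : X}
    (hx : x ∈ limitSet E) : (Classical.epsilon fun i => (i, x) ∈ coding E, x) ∈ coding E :=
  Classical.epsilon_spec (p := fun i => (i, x) ∈ coding E) (hE.exists_mem_coding hx)

theorem IsMoranConstruction.mem_word (hE : IsMoranConstruction E r) {x : X}
    (hx : x ∈ limitSet E) (n : ℕ) : x ∈ E (word E x n) :=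
  mem_coding.1 (hE.mem_coding_epsilon hx) n

theorem IsMoranConstruction.word_eq (hE : IsMoranConstruction E r) {x : X}
    (hx : x ∈ limitSet E) {w : List (Fin m)} (hw : x ∈ E w) : word E x w.length = w :=
  hE.eq_of_mem (by simp) (hE.mem_word hx _) hw

end Word

/-! ### Geometry of the construction sets -/

theorem IsMoranConstruction.isCompact_limitSet (hE : IsMoranConstruction E r) :
    IsCompact (limitSet E) := by
  have h : ∀ n : ℕ, IsCompact (⋃ w ∈ {w : List (Fin m) | w.length = n}, E w) := fun n =>
    (List.finite_length_eq (Fin m) n).isCompact_biUnion fun w _ => hE.isCompact w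
  exact (h 0).of_isClosed_subset (isClosed_iInter fun n => (h n).isClosed) (iInter_subset _ 0)

theorem IsMoranConstruction.diam_mono (hE : IsMoranConstruction E r) {v w : List (Fin m)}
    (h : v <+: w) : Metric.diam (E w) ≤ Metric.diam (E v) :=
  Metric.diam_mono (hE.subset_of_prefix h) (hE.isCompact v).isBounded

theorem IsMoranConstruction.diam_pos [Nontrivial (Fin m)] (hE : IsMoranConstruction E r)
    (w : List (Fin m)) : 0 < Metric.diam (E w) := by
  obtain ⟨i, j, hij⟩ := exists_pair_ne (Fin m)
  obtain ⟨x, hx⟩ := hE.nonempty (w ++ [i])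
  obtain ⟨y, hy⟩ := hE.nonempty (w ++ [j])
  have hxy : x ≠ y := fun h => (hE.disjoint w i j hij).le_bot ⟨hx, h ▸ hy⟩
  exact (dist_pos.2 hxy).trans_le (Metric.dist_le_diam_of_mem (hE.isCompact w).isBounded
    (hE.nested _ _ hx) (hE.nested _ _ hy))

/-- A cylinder of the limit set is relatively open: near `x` the limit set is contained in
the construction set `E_w` that contains `x`. -/
theorem IsMoranConstruction.exists_closedBall_inter_subset (hE : IsMoranConstruction E r) {x : X}
    {w : List (Fin m)} (hx : x ∈ E w) :
    ∃ ρ > 0, Metric.closedBall x ρ ∩ limitSet E ⊆ E w := by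
  have hfin : {v : List (Fin m) | v.length = w.length ∧ v ≠ w}.Finite :=
    (List.finite_length_eq (Fin m) w.length).subset fun v hv => hv.1
  have hK : IsClosed (⋃ v ∈ {v : List (Fin m) | v.length = w.length ∧ v ≠ w}, E v) :=
    (hfin.isCompact_biUnion fun v _ => hE.isCompact v).isClosed
  have hxK : x ∈ (⋃ v ∈ {v : List (Fin m) | v.length = w.length ∧ v ≠ w}, E v)ᶜ := by
    intro h
    obtain ⟨v, hv, hxv⟩ := mem_iUnion₂.1 h
    exact hv.2 (hE.eq_of_mem hv.1 hxv hx)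
  obtain ⟨ρ, hρ, hsub⟩ := Metric.nhds_basis_closedBall.mem_iff.1 (hK.isOpen_compl.mem_nhds hxK)
  refine ⟨ρ, hρ, fun y hy => ?_⟩
  obtain ⟨v, hv, hyv⟩ := mem_limitSet.1 hy.2 w.length
  by_cases hvw : v = w
  · exact hvw ▸ hyv
  · exact absurd (mem_iUnion₂.2 ⟨v, ⟨hv, hvw⟩, hyv⟩) (hsub hy.1)

/-- Small construction sets around `x` are contained in any given ball about `x`. -/
theorem IsMoranConstruction.exists_subset_closedBall [Nonempty (Fin m)]
    (hE : IsMoranConstruction E r) {x : X} (hx : x ∈ limitSet E) {ρ : ℝ} (hρ : 0 < ρ) :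
    ∃ N, ∀ n ≥ N, E (word E x n) ⊆ Metric.closedBall x ρ := by
  have h1 := hE.diam_tendsto (Classical.epsilon fun i => (i, x) ∈ coding E)
  obtain ⟨N, hN⟩ := eventually_atTop.1 (h1.eventually (gt_mem_nhds hρ))
  refine ⟨N, fun n hn y hy => ?_⟩
  exact (Metric.dist_le_diam_of_mem (hE.isCompact _).isBounded hy (hE.mem_word hx n)).trans
    (hN n hn).le

theorem IsMoranConstruction.exists_abs_sub_lt [Nonempty (Fin m)]
    (hE : IsMoranConstruction E r) {x : X} (hx : x ∈ limitSet E) {g : X → ℝ}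
    (hg : ContinuousOn g (limitSet E)) {ε : ℝ} (hε : 0 < ε) :
    ∃ N, ∀ n ≥ N, ∀ y ∈ limitSet E, y ∈ E (word E x n) → |g y - g x| < ε := by
  obtain ⟨ρ, hρ, h⟩ := Metric.continuousOn_iff.1 hg x hx ε hε
  obtain ⟨N, hN⟩ := hE.exists_subset_closedBall hx (half_pos hρ)
  refine ⟨N, fun n hn y hy hyw => ?_⟩
  have h1 := hN n hn hyw
  rw [Metric.mem_closedBall] at h1
  exact h y hy (by linarith)

/-- The uniform asymptotics of the diameters, read off the words. -/
theorem IsMoranConstruction.exists_abs_log_diam_sub_le [Nonempty (Fin m)]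
    (hE : IsMoranConstruction E r) {ε : ℝ} (hε : 0 < ε) :
    ∃ N, ∀ w : List (Fin m), N ≤ w.length → ∀ x ∈ limitSet E, x ∈ E w →
      |Real.log (Metric.diam (E w)) - Real.log (wordProd r w x)|
        ≤ ε * |Real.log (wordProd r w x)| := by
  have h := Metric.tendstoUniformlyOn_iff.1 hE.diam_asymp ε hε
  obtain ⟨N, hN⟩ := eventually_atTop.1 h
  refine ⟨N + 1, fun w hw x hx hxw => ?_⟩
  have h1 := hN w.length (by omega) _ (hE.mem_coding_epsilon hx)
  have h2 : pref (Classical.epsilon fun i => (i, x) ∈ coding E) w.length = w := hE.word_eq hx hxw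
  simp only [h2] at h1
  rw [dist_comm, Real.dist_eq] at h1
  have h3 : Real.log (wordProd r w x) < 0 := by
    rw [log_wordProd fun i => (hE.ratio_mem i x hx).1]
    cases w with
    | nil => simp at hw
    | cons a w =>
      have h4 := Real.log_neg (hE.ratio_mem a x hx).1 (hE.ratio_mem a x hx).2
      have h5 := sum_map_le (g := fun i => Real.log (r i x)) (C := 0)
        (fun i => (Real.log_neg (hE.ratio_mem i x hx).1 (hE.ratio_mem i x hx).2).le) w
      simp only [List.map_cons, List.sum_cons]
      linarith
  have h4 : Real.log (Metric.diam (E w)) - Real.log (wordProd r w x)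
      = (Real.log (Metric.diam (E w)) / Real.log (wordProd r w x) - 1)
        * Real.log (wordProd r w x) := by
    rw [sub_mul, div_mul_cancel₀ _ h3.ne, one_mul]
  rw [h4, abs_mul]
  exact mul_le_mul_of_nonneg_right h1.le (abs_nonneg _)

/-- Near `x` the diameter of `E_w` is governed by the ratios at the point `x`. -/
theorem IsMoranConstruction.exists_abs_log_diam_sub_sum_le [Nonempty (Fin m)]
    (hE : IsMoranConstruction E r) {x : X} (hx : x ∈ limitSet E) {ε : ℝ} (hε : 0 < ε) :
    ∃ N, ∀ w, word E x N <+: w →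
      |Real.log (Metric.diam (E w)) - (w.map fun i => Real.log (r i x)).sum| ≤ ε * w.length := by
  obtain ⟨R, hR0, hR⟩ : ∃ R > 0, ∀ i, |Real.log (r i x)| ≤ R := by
    obtain ⟨j, -, hj⟩ := Finset.exists_max_image Finset.univ (fun i => |Real.log (r i x)|)
      Finset.univ_nonempty
    exact ⟨|Real.log (r j x)| + 1, by positivity,
      fun i => (hj i (Finset.mem_univ i)).trans (by linarith)⟩
  have hη : 0 < min 1 (ε / 2) := by positivity
  obtain ⟨N₁, hN₁⟩ := hE.exists_abs_log_diam_sub_le (ε := ε / 2 / (R + 1)) (by positivity)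
  choose N₂ hN₂ using fun i => hE.exists_abs_sub_lt hx
    ((hE.ratio_continuous i).log fun y hy => (hE.ratio_mem i y hy).1.ne') hη
  obtain ⟨N₃, hN₃⟩ : ∃ N, ∀ i, N₂ i ≤ N :=
    ⟨Finset.univ.sup N₂, fun i => Finset.le_sup (Finset.mem_univ i)⟩
  refine ⟨max N₁ N₃, fun w hw => ?_⟩
  obtain ⟨y, hy, hyw⟩ := hE.exists_mem_limitSet w
  have hlen : max N₁ N₃ ≤ w.length := by simpa using hw.length_le
  have h1 := hN₁ w ((le_max_left _ _).trans hlen) y hy hyw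
  have h2 : ∀ i, |Real.log (r i y) - Real.log (r i x)| ≤ min 1 (ε / 2) := fun i =>
    (hN₂ i _ ((hN₃ i).trans (le_max_right _ _)) y hy (hE.subset_of_prefix hw hyw)).le
  rw [log_wordProd fun i => (hE.ratio_mem i y hy).1] at h1
  have h3 := abs_sum_map_sub_le h2 w
  have h4 : |(w.map fun i => Real.log (r i y)).sum| ≤ (R + 1) * w.length := by
    have h5 := abs_sum_map_sub_le (g := fun i => Real.log (r i y)) (h := fun _ => 0) (ε := R + 1)
      (fun i => by
        have h6 := abs_sub_abs_le_abs_sub (Real.log (r i y)) (Real.log (r i x))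
        have h7 := (h2 i).trans (min_le_left _ _)
        have h8 := hR i
        rw [sub_zero]
        linarith) w
    simpa using h5
  have hl : (0 : ℝ) ≤ w.length := Nat.cast_nonneg _
  have h5 : ε / 2 / (R + 1) * |(w.map fun i => Real.log (r i y)).sum| ≤ ε / 2 * w.length := by
    calc _ ≤ ε / 2 / (R + 1) * ((R + 1) * w.length) := by gcongr
      _ = ε / 2 * w.length := by field_simp
  have h6 : min 1 (ε / 2) * (w.length : ℝ) ≤ ε / 2 * w.length := by
    gcongr; exact min_le_right _ _
  have h7 := abs_sub_le (Real.log (Metric.diam (E w))) ((w.map fun i => Real.log (r i y)).sum)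
    ((w.map fun i => Real.log (r i x)).sum)
  linarith

theorem IsMoranConstruction.exists_log_ratio_le [Nonempty (Fin m)]
    (hE : IsMoranConstruction E r) :
    ∃ β > 0, ∀ i, ∀ x ∈ limitSet E, Real.log (r i x) ≤ -β := by
  have h : ∀ i, ∃ β > 0, ∀ x ∈ limitSet E, Real.log (r i x) ≤ -β := fun i => by
    obtain ⟨x₀, hx₀, -⟩ := hE.exists_mem_limitSet []
    obtain ⟨y, hy, hmax⟩ := hE.isCompact_limitSet.exists_isMaxOn ⟨x₀, hx₀⟩
      ((hE.ratio_continuous i).log fun y hy => (hE.ratio_mem i y hy).1.ne')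
    refine ⟨-Real.log (r i y), ?_, fun x hx => ?_⟩
    · exact neg_pos.2 (Real.log_neg (hE.ratio_mem i y hy).1 (hE.ratio_mem i y hy).2)
    · rw [neg_neg]; exact hmax hx
  choose β hβ hle using h
  obtain ⟨j, -, hj⟩ := Finset.exists_min_image Finset.univ β Finset.univ_nonempty
  exact ⟨β j, hβ j, fun i x hx => (hle i x hx).trans (neg_le_neg (hj i (Finset.mem_univ i)))⟩

/-- The diameters decay exponentially in the length of the word, uniformly. -/
theorem IsMoranConstruction.exists_log_diam_le [Nontrivial (Fin m)]
    (hE : IsMoranConstruction E r) :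
    ∃ b > 0, ∃ K, 0 ≤ K ∧ ∀ w : List (Fin m), Real.log (Metric.diam (E w)) ≤ K - b * w.length := by
  obtain ⟨β, hβ, hr⟩ := hE.exists_log_ratio_le
  obtain ⟨N, hN⟩ := hE.exists_abs_log_diam_sub_le (ε := 1 / 2) (by norm_num)
  refine ⟨β / 2, by positivity, |Real.log (Metric.diam (E []))| + β / 2 * N, by positivity,
    fun w => ?_⟩
  rcases le_total N w.length with hw | hw
  · obtain ⟨y, hy, hyw⟩ := hE.exists_mem_limitSet w
    have h1 := hN w hw y hy hyw
    have h2 := sum_map_le (fun i => hr i y hy) w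
    rw [← log_wordProd fun i => (hE.ratio_mem i y hy).1] at h2
    have h3 : Real.log (wordProd r w y) ≤ 0 := by
      have : 0 ≤ β * w.length := by positivity
      linarith
    rw [abs_of_nonpos h3] at h1
    have h4 := (abs_le.1 h1).2
    have h5 : 0 ≤ |Real.log (Metric.diam (E []))| := abs_nonneg _
    have h6 : 0 ≤ β / 2 * N := by positivity
    linarith
  · have h1 := Real.log_le_log (hE.diam_pos w) (hE.diam_mono (List.nil_prefix (l := w)))
    have h2 := le_abs_self (Real.log (Metric.diam (E [])))
    have h3 : β / 2 * (w.length : ℝ) ≤ β / 2 * N := by gcongr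
    linarith

theorem IsMoranConstruction.exists_diam_le_mul [Nontrivial (Fin m)]
    (hE : IsMoranConstruction E r) :
    ∃ C : ℝ, 1 ≤ C ∧ ∀ w i, Metric.diam (E w) ≤ C * Metric.diam (E (w ++ [i])) := by
  obtain ⟨C, -, h⟩ := hE.diam_ratio
  refine ⟨max 1 C, le_max_left _ _, fun w i => ?_⟩
  exact (div_le_iff₀ (hE.diam_pos _)).1 ((h w i).trans (le_max_right _ _))

end Coding

/-! ### Cuts of the tree of words at a given scale -/

section Cut

variable {X : Type*} [MetricSpace X] {m : ℕ} {E : List (Fin m) → Set X} {r : Fin m → X → ℝ}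

/-- A finite set `T` of words below `u` that cuts the tree at scale `δ`: the construction sets
`E_w`, `w ∈ T`, are disjoint, have diameter comparable to `δ` up to the factor `C`, and cover the
part of the limit set in `E_u`. The field `sum_eq` is the combinatorial form of being a cut:
a function on words that is additive on children has the same total on `T` as at the root `u`. -/
structure IsCut (E : List (Fin m) → Set X) (C : ℝ) (u : List (Fin m)) (δ : ℝ)
    (T : Finset (List (Fin m))) : Prop where
  root_prefix : ∀ w ∈ T, u <+: w
  diam_le : ∀ w ∈ T, Metric.diam (E w) ≤ δ
  le_mul_diam : ∀ w ∈ T, δ ≤ C * Metric.diam (E w)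
  cover : ∀ x ∈ limitSet E, x ∈ E u → ∃ w ∈ T, x ∈ E w
  disjoint : ∀ w ∈ T, ∀ w' ∈ T, w ≠ w' → Disjoint (E w) (E w')
  sum_eq : ∀ f : List (Fin m) → ℝ, (∀ w, f w = ∑ i, f (w ++ [i])) → ∑ w ∈ T, f w = f u

theorem IsMoranConstruction.exists_isCut_of_length (hE : IsMoranConstruction E r) {C δ : ℝ}
    (hC : ∀ w i, Metric.diam (E w) ≤ C * Metric.diam (E (w ++ [i]))) (n : ℕ) (u : List (Fin m))
    (hu : δ ≤ C * Metric.diam (E u))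
    (hn : ∀ w : List (Fin m), u.length + n ≤ w.length → Metric.diam (E w) ≤ δ) :
    ∃ T, IsCut E C u δ T := by
  classical
  induction n generalizing u with
  | zero =>
    exact ⟨{u}, by simp, by simpa using hn u (by simp), by simpa using hu, by simp,
      by simp +contextual, by simp⟩
  | succ n ih =>
    by_cases hd : Metric.diam (E u) ≤ δ
    · exact ⟨{u}, by simp, by simpa using hd, by simpa using hu, by simp,
        by simp +contextual, by simp⟩
    have h1 : ∀ i, ∃ T, IsCut E C (u ++ [i]) δ T := fun i =>
      ih _ ((not_le.1 hd).le.trans (hC u i)) fun w hw => hn w (by simp at hw; omega)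
    choose T hT using h1
    have hpre : ∀ i, ∀ w ∈ T i, u ++ [i] <+: w := fun i => (hT i).root_prefix
    have hij : ∀ {i j w}, w ∈ T i → w ∈ T j → i = j := fun {i j w} hi hj => by
      have := (List.prefix_of_prefix_length_le (hpre i w hi) (hpre j w hj)
        (by simp)).eq_of_length (by simp)
      simpa using this
    refine ⟨Finset.univ.biUnion T, ?_, ?_, ?_, ?_, ?_, ?_⟩
    · intro w hw
      obtain ⟨i, -, hi⟩ := Finset.mem_biUnion.1 hw
      exact (List.prefix_append _ _).trans (hpre i w hi)
    · intro w hw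
      obtain ⟨i, -, hi⟩ := Finset.mem_biUnion.1 hw
      exact (hT i).diam_le w hi
    · intro w hw
      obtain ⟨i, -, hi⟩ := Finset.mem_biUnion.1 hw
      exact (hT i).le_mul_diam w hi
    · intro x hx hxu
      obtain ⟨v, hv, hxv⟩ := mem_limitSet.1 hx (u.length + 1)
      obtain ⟨t, ht⟩ := hE.prefix_of_mem (by omega) hxu hxv
      have h3 : t.length = 1 := by
        have := congrArg List.length ht
        simp only [List.length_append] at this
        omega
      obtain ⟨i, rfl⟩ := List.length_eq_one_iff.1 h3
      obtain ⟨w, hw, hxw⟩ := (hT i).cover x hx (ht ▸ hxv)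
      exact ⟨w, Finset.mem_biUnion.2 ⟨i, Finset.mem_univ i, hw⟩, hxw⟩
    · intro w hw w' hw' hne
      obtain ⟨i, -, hi⟩ := Finset.mem_biUnion.1 hw
      obtain ⟨j, -, hj⟩ := Finset.mem_biUnion.1 hw'
      by_cases h : i = j
      · subst h
        exact (hT i).disjoint w hi w' hj hne
      · exact (hE.disjoint u i j h).mono (hE.subset_of_prefix (hpre i w hi))
          (hE.subset_of_prefix (hpre j w' hj))
    · intro f hf
      rw [Finset.sum_biUnion, hf u]
      · exact Finset.sum_congr rfl fun i _ => (hT i).sum_eq f hf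
      · intro i _ j _ hne
        exact Finset.disjoint_left.2 fun w hi hj => hne (hij hi hj)

theorem IsMoranConstruction.exists_isCut [Nontrivial (Fin m)] (hE : IsMoranConstruction E r)
    {C δ : ℝ} (hC : ∀ w i, Metric.diam (E w) ≤ C * Metric.diam (E (w ++ [i]))) (hδ : 0 < δ)
    {u : List (Fin m)} (hu : δ ≤ C * Metric.diam (E u)) : ∃ T, IsCut E C u δ T := by
  obtain ⟨b, hb, K, -, hK⟩ := hE.exists_log_diam_le
  obtain ⟨n, hn⟩ := exists_nat_gt ((K - Real.log δ) / b)
  rw [div_lt_iff₀ hb] at hn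
  refine hE.exists_isCut_of_length hC n u hu fun w hw => ?_
  refine (Real.log_le_log_iff (hE.diam_pos w) hδ).1 ((hK w).trans ?_)
  have h1 : (n : ℝ) ≤ w.length := by exact_mod_cast (by omega : n ≤ w.length)
  have h2 := mul_le_mul_of_nonneg_left h1 hb.le
  linarith

/-- A ball of radius comparable to `δ` meets a bounded number of the sets of a cut at scale `δ`:
they contain disjoint balls of radius comparable to `δ`. -/
theorem IsMoranConstruction.exists_card_overlap_le [Nontrivial (Fin m)] (hX : IsDoubling X)
    (hE : IsMoranConstruction E r) {C : ℝ} (hC : 0 < C) :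
    ∃ M : ℕ, ∀ (u : List (Fin m)) (δ : ℝ) (T : Finset (List (Fin m))), 0 < δ → IsCut E C u δ T →
      ∀ T' ⊆ T, ∀ y, (∀ w ∈ T', (E w ∩ Metric.closedBall y (2 * δ)).Nonempty) → T'.card ≤ M := by
  obtain ⟨C₀, hC₀, hball⟩ := hE.inner_ball
  choose c hc hcE using hball
  obtain ⟨M, hM⟩ := hX.exists_card_le (η := C₀ / (3 * C)) (by positivity)
  refine ⟨M, fun u δ T hδ hT T' hT' y hy => ?_⟩
  refine hM T' c y (3 * δ) (by positivity) (fun w hw => ?_) fun w hw w' hw' hne => ?_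
  · obtain ⟨z, hzw, hzy⟩ := hy w hw
    have h1 := Metric.dist_le_diam_of_mem (hE.isCompact w).isBounded (hc w) hzw
    have h2 := hT.diam_le w (hT' hw)
    have h3 := dist_triangle (c w) z y
    rw [Metric.mem_closedBall] at hzy
    linarith
  · have h1 : c w' ∉ Metric.closedBall (c w) (C₀ * Metric.diam (E w)) := fun h =>
      (hT.disjoint w (hT' hw) w' (hT' hw') hne).le_bot ⟨hcE w h, hc w'⟩
    rw [Metric.mem_closedBall, not_le, dist_comm] at h1
    refine lt_of_le_of_lt ?_ h1
    calc C₀ / (3 * C) * (3 * δ) = C₀ / C * δ := by field_simp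
      _ ≤ C₀ / C * (C * Metric.diam (E w)) := by gcongr; exact hT.le_mul_diam w (hT' hw)
      _ = C₀ * Metric.diam (E w) := by field_simp

/-- At every scale some construction set along the code of `x` has comparable diameter. -/
theorem IsMoranConstruction.exists_word_scale [Nontrivial (Fin m)]
    (hE : IsMoranConstruction E r) {C δ : ℝ}
    (hC : ∀ w i, Metric.diam (E w) ≤ C * Metric.diam (E (w ++ [i]))) (hδ : 0 < δ)
    (hδC : δ ≤ C * Metric.diam (E [])) {x : X} (hx : x ∈ limitSet E) :
    ∃ n, Metric.diam (E (word E x n)) ≤ δ ∧ δ ≤ C * Metric.diam (E (word E x n)) := by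
  obtain ⟨T, hT⟩ := hE.exists_isCut hC hδ hδC
  obtain ⟨w, hw, hxw⟩ := hT.cover x hx (by
    have := hE.mem_word hx 0
    rwa [List.length_eq_zero_iff.1 (length_word x 0)] at this)
  rw [← hE.word_eq hx hxw] at hw
  exact ⟨_, hT.diam_le _ hw, hT.le_mul_diam _ hw⟩

end Cut

/-! ### Measures with asymptotic weights -/

section Weights

variable {X : Type*} [MetricSpace X] [MeasurableSpace X] {m : ℕ} {E : List (Fin m) → Set X}
  {r p : Fin m → X → ℝ} {μ : Measure X}

/-- The hypotheses on the measure: its support is the limit set, and along every code its weights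
converge, uniformly, to the probability vector `(p_1, …, p_m)` at the coded point. -/
structure HasLimitWeights (μ : Measure X) (E : List (Fin m) → Set X) (p : Fin m → X → ℝ) :
    Prop where
  support_eq : μ.support = limitSet E
  continuousOn : ∀ i, ContinuousOn (p i) (limitSet E)
  mem_Ioo : ∀ i, ∀ x ∈ limitSet E, p i x ∈ Ioo (0 : ℝ) 1
  sum_eq_one : ∀ x ∈ limitSet E, ∑ i, p i x = 1
  exists_lt : ∃ a : ℝ, 0 < a ∧ ∀ i, ∀ x ∈ limitSet E, a < p i x
  tendsto : ∀ i, TendstoUniformlyOn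
    (fun n (z : (ℕ → Fin m) × X) => weight μ E (pref z.1 n) i) (fun z => p i z.2) atTop (coding E)

theorem HasLimitWeights.nontrivial [SecondCountableTopology X] [IsProbabilityMeasure μ]
    (hμ : HasLimitWeights μ E p) : Nontrivial (Fin m) := by
  obtain ⟨x, hx⟩ := Measure.nonempty_support (IsProbabilityMeasure.ne_zero μ)
  rw [hμ.support_eq] at hx
  have hs := hμ.sum_eq_one x hx
  by_contra hn
  rw [not_nontrivial_iff_subsingleton] at hn
  rcases isEmpty_or_nonempty (Fin m) with h | ⟨⟨i⟩⟩
  · simp at hs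
  · rw [Fintype.sum_subsingleton _ i] at hs
    exact (hμ.mem_Ioo i x hx).2.ne hs

theorem HasLimitWeights.ae_mem [SecondCountableTopology X]
    (hμ : HasLimitWeights μ E p) : ∀ᵐ x ∂μ, x ∈ limitSet E :=
  hμ.support_eq ▸ Measure.support_mem_ae

theorem IsMoranConstruction.measurableSet [BorelSpace X] (hE : IsMoranConstruction E r)
    (w : List (Fin m)) : MeasurableSet (E w) := (hE.isCompact w).measurableSet

theorem HasLimitWeights.measure_pos [Nonempty (Fin m)] [SecondCountableTopology X]
    (hE : IsMoranConstruction E r) (hμ : HasLimitWeights μ E p) (w : List (Fin m)) :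
    0 < μ (E w) := by
  obtain ⟨x, hx, hxw⟩ := hE.exists_mem_limitSet w
  obtain ⟨ρ, hρ, hsub⟩ := hE.exists_closedBall_inter_subset hxw
  have h1 : 0 < μ (Metric.closedBall x ρ) :=
    (Measure.mem_support_iff_forall x).1 (hμ.support_eq ▸ hx) _ (Metric.closedBall_mem_nhds x hρ)
  refine h1.trans_le (measure_mono_ae ?_)
  filter_upwards [hμ.ae_mem] with y hy hyx using hsub ⟨hyx, hy⟩

theorem HasLimitWeights.exists_abs_weight_sub_lt [Nonempty (Fin m)]
    (hE : IsMoranConstruction E r)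
    (hμ : HasLimitWeights μ E p) {ε : ℝ} (hε : 0 < ε) :
    ∃ N, ∀ w : List (Fin m), N ≤ w.length → ∀ x ∈ limitSet E, x ∈ E w → ∀ i,
      |weight μ E w i - p i x| < ε := by
  choose N hN using fun i =>
    eventually_atTop.1 (Metric.tendstoUniformlyOn_iff.1 (hμ.tendsto i) ε hε)
  refine ⟨Finset.univ.sup N, fun w hw x hx hxw i => ?_⟩
  have h1 := hN i w.length ((Finset.le_sup (Finset.mem_univ i)).trans hw) _
    (hE.mem_coding_epsilon hx)
  have h2 : pref (Classical.epsilon fun i => (i, x) ∈ coding E) w.length = w := hE.word_eq hx hxw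
  rwa [h2, dist_comm, Real.dist_eq] at h1

variable [Nonempty (Fin m)] [SecondCountableTopology X] [IsProbabilityMeasure μ]

theorem HasLimitWeights.measureReal_pos (hE : IsMoranConstruction E r)
    (hμ : HasLimitWeights μ E p) (w : List (Fin m)) : 0 < μ.real (E w) :=
  ENNReal.toReal_pos (hμ.measure_pos hE w).ne' (measure_ne_top _ _)

theorem HasLimitWeights.measureReal_append (hE : IsMoranConstruction E r)
    (hμ : HasLimitWeights μ E p) (w : List (Fin m)) (i : Fin m) :
    μ.real (E (w ++ [i])) = weight μ E w i * μ.real (E w) := by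
  rw [weight, div_mul_cancel₀ _ (hμ.measureReal_pos hE w).ne']

theorem HasLimitWeights.weight_pos (hE : IsMoranConstruction E r)
    (hμ : HasLimitWeights μ E p) (w : List (Fin m)) (i : Fin m) : 0 < weight μ E w i :=
  div_pos (hμ.measureReal_pos hE _) (hμ.measureReal_pos hE _)

/-- The measure of `E_w` is at least exponentially small in the length of `w`, uniformly. -/
theorem HasLimitWeights.exists_le_log_measureReal (hE : IsMoranConstruction E r)
    (hμ : HasLimitWeights μ E p) :
    ∃ C, 0 ≤ C ∧ ∀ w : List (Fin m), -(C * (w.length + 1)) ≤ Real.log (μ.real (E w)) := by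
  obtain ⟨a, ha, hp⟩ := hμ.exists_lt
  obtain ⟨N, hN⟩ := hμ.exists_abs_weight_sub_lt hE (half_pos ha)
  -- Long words have weights at least `a / 2`; the finitely many short ones have positive weights.
  have hfin : {w : List (Fin m) | w.length < N}.Finite := List.finite_length_lt (Fin m) N
  obtain ⟨c, hc, hcw⟩ : ∃ c > 0, ∀ w i, c ≤ weight μ E w i := by
    have h1 : ∃ c > 0, ∀ z ∈ hfin.toFinset ×ˢ (Finset.univ : Finset (Fin m)),
        c ≤ weight μ E z.1 z.2 := by
      rcases (hfin.toFinset ×ˢ (Finset.univ : Finset (Fin m))).eq_empty_or_nonempty with h | h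
      · exact ⟨1, one_pos, by simp [h]⟩
      · obtain ⟨z, -, hz⟩ := Finset.exists_min_image _ (fun z : List (Fin m) × Fin m =>
          weight μ E z.1 z.2) h
        exact ⟨_, hμ.weight_pos hE z.1 z.2, hz⟩
    obtain ⟨c, hc, h⟩ := h1
    refine ⟨min c (a / 2), by positivity, fun w i => ?_⟩
    rcases lt_or_ge w.length N with hw | hw
    · exact (min_le_left _ _).trans (h (w, i) (by simpa using hw))
    · obtain ⟨x, hx, hxw⟩ := hE.exists_mem_limitSet w
      have h2 := (abs_lt.1 (hN w hw x hx hxw i)).1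
      have h3 := hp i x hx
      exact (min_le_right _ _).trans (by linarith)
  refine ⟨|Real.log c| + |Real.log (μ.real (E []))|, by positivity, fun w => ?_⟩
  have h2 : -(|Real.log c| * w.length + |Real.log (μ.real (E []))|)
      ≤ Real.log (μ.real (E w)) := by
    induction w using List.reverseRecOn with
    | nil => simpa using neg_abs_le _
    | append_singleton w i ih =>
      rw [hμ.measureReal_append hE, Real.log_mul (hμ.weight_pos hE w i).ne'
        (hμ.measureReal_pos hE w).ne']
      have h3 := Real.log_le_log hc (hcw w i)
      have h4 := neg_abs_le (Real.log c)
      simp only [List.length_append, List.length_singleton]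
      push_cast
      linarith
  refine le_trans ?_ h2
  have h5 : (0 : ℝ) ≤ w.length := Nat.cast_nonneg _
  have h6 := mul_nonneg (abs_nonneg (Real.log (μ.real (E [])))) h5
  have h7 := abs_nonneg (Real.log c)
  linarith

/-- Near `x` the measure of `E_w` is governed by the probabilities at the point `x`. -/
theorem HasLimitWeights.exists_abs_log_measureReal_sub_sum_le (hE : IsMoranConstruction E r)
    (hμ : HasLimitWeights μ E p) {x : X} (hx : x ∈ limitSet E) {ε : ℝ} (hε : 0 < ε) :
    ∃ N K, ∀ w, word E x N <+: w →
      |Real.log (μ.real (E w)) - (w.map fun i => Real.log (p i x)).sum| ≤ K + ε * w.length := by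
  obtain ⟨η, hη, hlog⟩ : ∃ η > 0, ∀ i t, |t - p i x| < η → |Real.log t - Real.log (p i x)| < ε := by
    choose η hη h using fun i => Metric.continuousAt_iff.1
      (Real.continuousAt_log (hμ.mem_Ioo i x hx).1.ne') ε hε
    obtain ⟨j, -, hj⟩ := Finset.exists_min_image Finset.univ η Finset.univ_nonempty
    exact ⟨η j, hη j, fun i t ht => h i (ht.trans_le (hj i (Finset.mem_univ i)))⟩
  obtain ⟨N₁, hN₁⟩ := hμ.exists_abs_weight_sub_lt hE (half_pos hη)
  choose N₂ hN₂ using fun i => hE.exists_abs_sub_lt hx (hμ.continuousOn i) (half_pos hη)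
  set N := max N₁ (Finset.univ.sup N₂) with hN
  refine ⟨N, |Real.log (μ.real (E (word E x N)))
    - ((word E x N).map fun i => Real.log (p i x)).sum|, fun w hw => ?_⟩
  have hstep : ∀ w, word E x N <+: w → ∀ i,
      |Real.log (weight μ E w i) - Real.log (p i x)| < ε := fun w hw i => by
    obtain ⟨y, hy, hyw⟩ := hE.exists_mem_limitSet w
    have hlen : N ≤ w.length := by simpa using hw.length_le
    have h1 := hN₁ w ((le_max_left _ _).trans hlen) y hy hyw i
    have h2 := hN₂ i N ((Finset.le_sup (Finset.mem_univ i)).trans (le_max_right _ _)) y hy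
      (hE.subset_of_prefix hw hyw)
    refine hlog i _ ((abs_sub_le _ (p i y) _).trans_lt ?_)
    linarith
  obtain ⟨v, rfl⟩ := hw
  induction v using List.reverseRecOn with
  | nil =>
    rw [List.append_nil, le_add_iff_nonneg_right]
    positivity
  | append_singleton v i ih =>
    rw [← List.append_assoc, hμ.measureReal_append hE, Real.log_mul (hμ.weight_pos hE _ i).ne'
      (hμ.measureReal_pos hE _).ne', List.map_append, List.sum_append]
    have h1 := hstep _ (List.prefix_append (word E x N) v) i
    have h2 : ((word E x N ++ v ++ [i]).length : ℝ) = (word E x N ++ v).length + 1 := by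
      rw [List.length_append (as := word E x N ++ v)]
      simp
    rw [h2, List.map_singleton, List.sum_singleton]
    rw [abs_le] at ih ⊢
    rw [abs_lt] at h1
    constructor <;> linarith [ih.1, ih.2, h1.1, h1.2]

variable [BorelSpace X]

theorem HasLimitWeights.measureReal_eq_sum (hE : IsMoranConstruction E r)
    (hμ : HasLimitWeights μ E p) (w : List (Fin m)) :
    μ.real (E w) = ∑ i, μ.real (E (w ++ [i])) := by
  have h1 : E w =ᵐ[μ] ⋃ i, E (w ++ [i]) := by
    filter_upwards [hμ.ae_mem] with x hx
    refine propext ⟨fun h => ?_, fun h => ?_⟩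
    · have h2 : word E x w.length = w := hE.word_eq hx h
      obtain ⟨i, hi⟩ := word_succ (E := E) x w.length
      exact mem_iUnion.2 ⟨i, by rw [← congrArg (· ++ [i]) h2, ← hi]; exact hE.mem_word hx _⟩
    · obtain ⟨i, hi⟩ := mem_iUnion.1 h
      exact hE.nested _ _ hi
  rw [measureReal_congr h1]
  exact measureReal_iUnion_fintype (fun i j hij => hE.disjoint w i j hij)
    fun i => hE.measurableSet _

theorem HasLimitWeights.sum_weight (hE : IsMoranConstruction E r)
    (hμ : HasLimitWeights μ E p) (w : List (Fin m)) : ∑ i, weight μ E w i = 1 := by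
  simp only [weight]
  rw [← Finset.sum_div, ← hμ.measureReal_eq_sum hE, div_self (hμ.measureReal_pos hE w).ne']

theorem HasLimitWeights.weight_le_one (hE : IsMoranConstruction E r)
    (hμ : HasLimitWeights μ E p) (w : List (Fin m)) (i : Fin m) : weight μ E w i ≤ 1 := by
  rw [← hμ.sum_weight hE w]
  exact Finset.single_le_sum (fun j _ => (hμ.weight_pos hE w j).le) (Finset.mem_univ i)

end Weights

/-! ### The `L^q`-spectrum -/

section Lq

/-- In a finite weighted graph with at most `M` neighbours at each vertex (the vertex included),
an independent set carries at least `1 / M` of the weight: pick a vertex of maximal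
weight, delete its neighbours, and continue. -/
theorem exists_independent_sum_le {ι : Type*} {R : ι → ι → Prop} (hrefl : ∀ i, R i i)
    (hsymm : ∀ i j, R i j → R j i) (a : ι → ℝ≥0∞) {M : ℕ} (T : Finset ι)
    (hM : ∀ T' ⊆ T, ∀ i ∈ T, (∀ j ∈ T', R i j) → T'.card ≤ M) :
    ∃ I ⊆ T, (∀ i ∈ I, ∀ j ∈ I, i ≠ j → ¬ R i j) ∧ ∑ i ∈ T, a i ≤ M * ∑ i ∈ I, a i := by
  classical
  induction T using Finset.strongInduction with
  | H T ih =>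
    rcases T.eq_empty_or_nonempty with rfl | hT
    · exact ⟨∅, by simp, by simp, by simp⟩
    obtain ⟨i, hi, hmax⟩ := Finset.exists_max_image T a hT
    have hss : T.filter (fun j => ¬ R i j) ⊂ T :=
      (Finset.filter_ssubset).2 ⟨i, hi, by simpa using hrefl i⟩
    obtain ⟨I, hI, hind, hsum⟩ := ih _ hss fun T' hT' j hj =>
      hM T' (hT'.trans hss.subset) j (hss.subset hj)
    have hiI : i ∉ I := fun h => (Finset.mem_filter.1 (hI h)).2 (hrefl i)
    refine ⟨insert i I, ?_, ?_, ?_⟩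
    · exact Finset.insert_subset hi (hI.trans hss.subset)
    · intro j hj k hk hjk
      rcases Finset.mem_insert.1 hj with h₁ | h₁ <;> rcases Finset.mem_insert.1 hk with h₂ | h₂
      · exact absurd (h₁.trans h₂.symm) hjk
      · exact h₁ ▸ (Finset.mem_filter.1 (hI h₂)).2
      · exact fun h => (Finset.mem_filter.1 (hI h₁)).2 (h₂ ▸ hsymm _ _ h)
      · exact hind j h₁ k h₂ hjk
    · rw [← Finset.sum_filter_add_sum_filter_not T (R i), Finset.sum_insert hiI, mul_add]
      refine add_le_add ?_ hsum
      calc ∑ j ∈ T.filter (R i), a j ≤ (T.filter (R i)).card • a i :=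
            Finset.sum_le_card_nsmul _ _ _ fun j hj => hmax j (Finset.mem_filter.1 hj).1
        _ ≤ M * a i := by
            rw [nsmul_eq_mul]
            gcongr
            exact hM _ (Finset.filter_subset _ _) i hi fun j hj => (Finset.mem_filter.1 hj).2

variable {X : Type*} [MetricSpace X] [MeasurableSpace X] {m : ℕ} {E : List (Fin m) → Set X}
  {r p : Fin m → X → ℝ} {μ : Measure X}

variable [Nontrivial (Fin m)]

/-- A cut below `u` yields a packing of a ball around `E_u`: choose a point of the limit set in
each member, and thin out by bounded overlap. -/
theorem HasLimitWeights.exists_sum_le_packingSum (hX : IsDoubling X)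
    (hE : IsMoranConstruction E r) (hμ : HasLimitWeights μ E p) {C : ℝ} (hC : 0 < C) {q : ℝ}
    (hq : 0 ≤ q) :
    ∃ M : ℕ, ∀ (u : List (Fin m)) (δ : ℝ) (T : Finset (List (Fin m))) (x : X) (ρ : ℝ), 0 < δ →
      IsCut E C u δ T → E u ⊆ Metric.closedBall x ρ →
      ∑ w ∈ T, μ (E w) ^ q ≤ M * packingSum μ q δ ρ x := by
  classical
  obtain ⟨M, hM⟩ := hE.exists_card_overlap_le hX hC
  choose y hy hyE using hE.exists_mem_limitSet
  refine ⟨M, fun u δ T x ρ hδ hT hu => ?_⟩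
  obtain ⟨I, hIT, hI, hsum⟩ := exists_independent_sum_le
    (R := fun w w' => ¬ Disjoint (Metric.closedBall (y w) δ) (Metric.closedBall (y w') δ))
    (fun w h => h.le_bot ⟨Metric.mem_closedBall_self hδ.le, Metric.mem_closedBall_self hδ.le⟩)
    (fun w w' h h' => h h'.symm) (fun w => μ (E w) ^ q) (M := M) T fun T' hT' w hw hR => by
      refine hM u δ T hδ hT T' hT' (y w) fun w' hw' => ⟨y w', hyE w', ?_⟩
      obtain ⟨z, hz, hz'⟩ := not_disjoint_iff.1 (hR w' hw')
      rw [Metric.mem_closedBall] at hz hz' ⊢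
      have := dist_triangle_left (y w') (y w) z
      linarith
  refine hsum.trans (mul_le_mul_right ?_ _)
  have hinj : Set.InjOn y I := fun w hw w' hw' h => by
    by_contra hne
    exact (hT.disjoint w (hIT hw) w' (hIT hw') hne).le_bot ⟨hyE w, h ▸ hyE w'⟩
  have hpack : IsPacking δ (Metric.closedBall x ρ ∩ μ.support) (I.image y : Finset X) := by
    refine ⟨?_, Finset.countable_toSet _, ?_⟩
    · intro c hc
      obtain ⟨w, hw, rfl⟩ := Finset.mem_image.1 hc
      exact ⟨hu (hE.subset_of_prefix (hT.root_prefix w (hIT hw)) (hyE w)),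
        hμ.support_eq ▸ hy w⟩
    · intro c hc c' hc' hne
      obtain ⟨w, hw, rfl⟩ := Finset.mem_image.1 hc
      obtain ⟨w', hw', rfl⟩ := Finset.mem_image.1 hc'
      exact not_not.1 (hI w hw w' hw' fun h => hne (by rw [h]))
  refine le_trans ?_ (le_iSup₂ (f := fun (C : Set X)
    (_ : IsPacking δ (Metric.closedBall x ρ ∩ μ.support) C) =>
      ∑' c : C, μ (Metric.closedBall (c : X) δ) ^ q) _ hpack)
  rw [Finset.tsum_subtype' (I.image y) fun c => μ (Metric.closedBall c δ) ^ q,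
    Finset.sum_image hinj]
  refine Finset.sum_le_sum fun w hw => ENNReal.rpow_le_rpow (measure_mono fun z hz => ?_) hq
  exact (Metric.dist_le_diam_of_mem (hE.isCompact w).isBounded hz (hyE w)).trans
    (hT.diam_le w (hIT hw))

/-- The packing sum over a ball whose points of the limit set lie in `E_u` is bounded by the sum
over a cut below `u`: each ball of the packing meets a bounded number of members of the cut, and
each member of the cut meets a bounded number of balls. -/
theorem HasLimitWeights.exists_packingSum_le_sum [SecondCountableTopology X]
    (hX : IsDoubling X) (hE : IsMoranConstruction E r) (hμ : HasLimitWeights μ E p) {C : ℝ}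
    (hC : 0 < C) {q : ℝ} (hq : 0 ≤ q) :
    ∃ M : ℝ, 0 < M ∧ ∀ (u : List (Fin m)) (δ : ℝ) (T : Finset (List (Fin m))) (x : X) (ρ : ℝ),
      0 < δ → IsCut E C u δ T → Metric.closedBall x (ρ + δ) ∩ limitSet E ⊆ E u →
      packingSum μ q δ ρ x ≤ ENNReal.ofReal M * ∑ w ∈ T, μ (E w) ^ q := by
  classical
  obtain ⟨M₁, hM₁⟩ := hE.exists_card_overlap_le hX hC
  obtain ⟨M₂, hM₂⟩ := hX.exists_card_le (η := 1 / 3) (by norm_num)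
  refine ⟨(M₁ + 1 : ℝ) ^ q * (M₂ + 1), by positivity, fun u δ T x ρ hδ hT hu => ?_⟩
  refine iSup₂_le fun P hP => ?_
  rw [ENNReal.tsum_eq_iSup_sum]
  refine iSup_le fun F => ?_
  set N : P → Finset (List (Fin m)) := fun c =>
    T.filter fun w => (E w ∩ Metric.closedBall (c : X) (2 * δ)).Nonempty with hN
  have h1 : ∀ c : P, μ (Metric.closedBall (c : X) δ) ^ q
      ≤ (M₁ + 1 : ℝ≥0∞) ^ q * ∑ w ∈ N c, μ (E w) ^ q := fun c => by
    have hc := hP.1 c.2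
    rw [hμ.support_eq] at hc
    have hcover : ∀ z ∈ limitSet E, z ∈ Metric.closedBall (c : X) δ → ∃ w ∈ N c, z ∈ E w :=
      fun z hz hzc => by
        have h2 : z ∈ E u := hu ⟨by
          have h3 := hc.1
          rw [Metric.mem_closedBall] at hzc h3 ⊢
          have := dist_triangle z c x
          linarith, hz⟩
        obtain ⟨w, hw, hzw⟩ := hT.cover z hz h2
        exact ⟨w, Finset.mem_filter.2 ⟨hw, z, hzw,
          Metric.closedBall_subset_closedBall (by linarith) hzc⟩, hzw⟩
    obtain ⟨w₀, hw₀, -⟩ := hcover c hc.2 (Metric.mem_closedBall_self hδ.le)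
    obtain ⟨w, hw, hmax⟩ := Finset.exists_max_image (N c) (fun w => μ (E w)) ⟨w₀, hw₀⟩
    have h4 : μ (Metric.closedBall (c : X) δ) ≤ (M₁ + 1 : ℝ≥0∞) * μ (E w) := by
      calc μ (Metric.closedBall (c : X) δ) ≤ μ (⋃ w ∈ N c, E w) := by
            refine measure_mono_ae ?_
            filter_upwards [hμ.ae_mem] with z hz hzc
            obtain ⟨w, hw, hzw⟩ := hcover z hz hzc
            exact mem_iUnion₂.2 ⟨w, hw, hzw⟩
        _ ≤ ∑ w ∈ N c, μ (E w) := measure_biUnion_finset_le _ _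
        _ ≤ (N c).card • μ (E w) := Finset.sum_le_card_nsmul _ _ _ hmax
        _ ≤ (M₁ + 1 : ℝ≥0∞) * μ (E w) := by
            rw [nsmul_eq_mul]
            gcongr
            have := hM₁ u δ T hδ hT (N c) (Finset.filter_subset _ _) c fun w hw =>
              (Finset.mem_filter.1 hw).2
            exact_mod_cast this.trans (Nat.le_succ _)
    calc μ (Metric.closedBall (c : X) δ) ^ q ≤ ((M₁ + 1 : ℝ≥0∞) * μ (E w)) ^ q :=
          ENNReal.rpow_le_rpow h4 hq
      _ = (M₁ + 1 : ℝ≥0∞) ^ q * μ (E w) ^ q := ENNReal.mul_rpow_of_nonneg _ _ hq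
      _ ≤ _ := by
          gcongr
          exact Finset.single_le_sum (f := fun w => μ (E w) ^ q) (fun _ _ => zero_le) hw
  have h2 : ∀ w ∈ T, (F.filter fun c => w ∈ N c).card ≤ M₂ := fun w hw => by
    obtain ⟨z, hz⟩ := hE.nonempty w
    refine hM₂ _ (fun c : P => (c : X)) z (3 * δ) (by positivity) (fun c hc => ?_)
      fun c hc c' hc' hne => ?_
    · obtain ⟨z', hz', hz'c⟩ := (Finset.mem_filter.1 (Finset.mem_filter.1 hc).2).2
      have h3 := (Metric.dist_le_diam_of_mem (hE.isCompact w).isBounded hz' hz).trans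
        (hT.diam_le w hw)
      have h4 := dist_triangle_left (c : X) z z'
      rw [Metric.mem_closedBall] at hz'c
      linarith
    · have h3 := hP.2.2 c.2 c'.2 fun h => hne (Subtype.ext h)
      have h4 : (c : X) ∉ Metric.closedBall (c' : X) δ := fun h =>
        h3.le_bot ⟨Metric.mem_closedBall_self hδ.le, h⟩
      rw [Metric.mem_closedBall, not_le] at h4
      linarith
  calc ∑ c ∈ F, μ (Metric.closedBall (c : X) δ) ^ q
      ≤ ∑ c ∈ F, (M₁ + 1 : ℝ≥0∞) ^ q * ∑ w ∈ N c, μ (E w) ^ q :=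
        Finset.sum_le_sum fun c _ => h1 c
    _ = (M₁ + 1 : ℝ≥0∞) ^ q * ∑ w ∈ T, (F.filter fun c => w ∈ N c).card • μ (E w) ^ q := by
        rw [← Finset.mul_sum]
        congr 1
        rw [Finset.sum_comm' (t' := T) (s' := fun w => F.filter fun c => w ∈ N c)]
        · simp
        · intro c w
          simp only [hN, Finset.mem_filter]
          tauto
    _ ≤ (M₁ + 1 : ℝ≥0∞) ^ q * ∑ w ∈ T, (M₂ + 1 : ℝ≥0∞) * μ (E w) ^ q := by
        gcongr with w hw
        rw [nsmul_eq_mul]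
        gcongr
        exact_mod_cast (h2 w hw).trans (Nat.le_succ _)
    _ = ENNReal.ofReal ((M₁ + 1 : ℝ) ^ q * (M₂ + 1)) * ∑ w ∈ T, μ (E w) ^ q := by
        rw [← Finset.mul_sum, ← mul_assoc, ENNReal.ofReal_mul (by positivity),
          ← ENNReal.ofReal_rpow_of_pos (by positivity)]
        congr 3 <;> norm_cast

/-- The sum over a cut at scale `δ` below a construction set close to `x` behaves like `δ^τ`. With
`c_i = p_i(x)^q r_i(x)^{-τ}` the products of the `c_i` along words are additive on children, so
their sum over a cut does not depend on the cut; and for a member `w` of the cut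
`μ(E_w)^q δ^{-τ}` agrees with this product up to a small power of `δ`. -/
theorem HasLimitWeights.exists_abs_log_sum_sub_le [SecondCountableTopology X]
    [IsProbabilityMeasure μ] (hE : IsMoranConstruction E r) (hμ : HasLimitWeights μ E p)
    {C : ℝ} (hC : 0 < C) {q τ : ℝ} (hq : 0 ≤ q) {x : X} (hx : x ∈ limitSet E)
    (hτ : ∑ i, p i x ^ q * r i x ^ (-τ) = 1) {ε : ℝ} (hε : 0 < ε) :
    ∃ N₀, ∀ N ≥ N₀, ∃ K, ∀ δ T, 0 < δ → IsCut E C (word E x N) δ T →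
      |Real.log (∑ w ∈ T, μ.real (E w) ^ q) - τ * Real.log δ| ≤ K + ε * -Real.log δ := by
  obtain ⟨b, hb, K₂, hK₂, hlen⟩ := hE.exists_log_diam_le
  have hη : 0 < ε * b / (q + |τ| + 1) := by positivity
  set η := ε * b / (q + |τ| + 1) with hηdef
  obtain ⟨N₁, K₁, h₁⟩ := hμ.exists_abs_log_measureReal_sub_sum_le hE hx hη
  obtain ⟨N₂, h₂⟩ := hE.exists_abs_log_diam_sub_sum_le hx hη
  set c : Fin m → X → ℝ := fun i x => p i x ^ q * r i x ^ (-τ) with hc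
  have hcpos : ∀ i, 0 < c i x := fun i =>
    mul_pos (Real.rpow_pos_of_pos (hμ.mem_Ioo i x hx).1 _)
      (Real.rpow_pos_of_pos (hE.ratio_mem i x hx).1 _)
  have hfpos : ∀ w, 0 < wordProd c w x := fun w => List.prod_pos (by simpa using fun i _ => hcpos i)
  have hlogf : ∀ w, Real.log (wordProd c w x) = q * (w.map fun i => Real.log (p i x)).sum
      - τ * (w.map fun i => Real.log (r i x)).sum := fun w => by
    rw [log_wordProd hcpos]
    induction w with
    | nil => simp
    | cons i w ih =>
      have h3 : Real.log (c i x) = q * Real.log (p i x) - τ * Real.log (r i x) := by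
        have hp := (hμ.mem_Ioo i x hx).1
        have hr := (hE.ratio_mem i x hx).1
        rw [hc, Real.log_mul (Real.rpow_pos_of_pos hp _).ne' (Real.rpow_pos_of_pos hr _).ne',
          Real.log_rpow hp, Real.log_rpow hr]
        ring
      simp only [List.map_cons, List.sum_cons, ih, h3]
      ring
  refine ⟨max N₁ N₂, fun N hN => ?_⟩
  set u := word E x N
  refine ⟨|Real.log (wordProd c u x)| + (ε * (K₂ + |Real.log C|) + q * K₁ + |τ| * |Real.log C|),
    fun δ T hδ hT => ?_⟩
  set e := ε * (K₂ + |Real.log C|) + q * K₁ + |τ| * |Real.log C| + ε * -Real.log δ with he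
  -- The single terms differ from the products by a factor `e^{±e}`, since the length of a word
  -- of the cut is at most a multiple of `-log δ`.
  have hterm : ∀ w ∈ T, |q * Real.log (μ.real (E w)) - Real.log (wordProd c w x)
      - τ * Real.log δ| ≤ e := fun w hw => by
    have hpre := hT.root_prefix w hw
    have e1 := h₁ w ((word_prefix x ((le_max_left _ _).trans hN)).trans hpre)
    have e2 := h₂ w ((word_prefix x ((le_max_right _ _).trans hN)).trans hpre)
    have hd := hE.diam_pos w
    have e3 := Real.log_le_log hd (hT.diam_le w hw)
    have e4 := Real.log_le_log hδ (hT.le_mul_diam w hw)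
    rw [Real.log_mul hC.ne' hd.ne'] at e4
    have e5 := hlen w
    have e6 := le_abs_self (Real.log C)
    have e7 : |Real.log (Metric.diam (E w)) - Real.log δ| ≤ |Real.log C| := by
      rw [abs_le]; constructor <;> linarith [abs_nonneg (Real.log C)]
    rw [hlogf]
    have e8 : q * Real.log (μ.real (E w)) - (q * (w.map fun i => Real.log (p i x)).sum
          - τ * (w.map fun i => Real.log (r i x)).sum) - τ * Real.log δ
        = q * (Real.log (μ.real (E w)) - (w.map fun i => Real.log (p i x)).sum)
          + -τ * (Real.log (Metric.diam (E w)) - (w.map fun i => Real.log (r i x)).sum)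
          + τ * (Real.log (Metric.diam (E w)) - Real.log δ) := by ring
    rw [e8]
    refine (abs_add_three _ _ _).trans ?_
    rw [abs_mul, abs_mul, abs_mul, abs_neg, abs_of_nonneg hq]
    have e9 : q * |Real.log (μ.real (E w)) - (w.map fun i => Real.log (p i x)).sum|
        ≤ q * (K₁ + η * w.length) := by gcongr
    have e10 : |τ| * |Real.log (Metric.diam (E w)) - (w.map fun i => Real.log (r i x)).sum|
        ≤ |τ| * (η * w.length) := by gcongr
    have e11 : |τ| * |Real.log (Metric.diam (E w)) - Real.log δ| ≤ |τ| * |Real.log C| := by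
      gcongr
    have e12 : (q + |τ|) * (η * w.length) ≤ ε * (b * w.length) := by
      have : (q + |τ| + 1) * η = ε * b := by
        rw [hηdef]; field_simp
      have h0 : 0 ≤ η * w.length := by positivity
      calc (q + |τ|) * (η * w.length) ≤ (q + |τ| + 1) * (η * w.length) := by linarith
        _ = ε * (b * w.length) := by rw [← mul_assoc, this, mul_assoc]
    have e13 : ε * (b * w.length) ≤ ε * (K₂ + |Real.log C| + -Real.log δ) := by
      gcongr
      linarith
    rw [he]
    linarith
  have hrpow : ∀ w, μ.real (E w) ^ q = Real.exp (q * Real.log (μ.real (E w))) := fun w => by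
    rw [Real.rpow_def_of_pos (hμ.measureReal_pos hE w), mul_comm]
  have hsum : ∑ w ∈ T, wordProd c w x = wordProd c u x := by
    refine hT.sum_eq (fun w => wordProd c w x) fun w => ?_
    have : ∀ i, wordProd c (w ++ [i]) x = wordProd c w x * c i x := fun i => by simp [wordProd]
    rw [Finset.sum_congr rfl fun i _ => this i, ← Finset.mul_sum, hτ, mul_one]
  have hupper : ∑ w ∈ T, μ.real (E w) ^ q
      ≤ wordProd c u x * Real.exp (τ * Real.log δ + e) := by
    rw [← hsum, Finset.sum_mul]
    refine Finset.sum_le_sum fun w hw => ?_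
    rw [hrpow, ← Real.exp_log (hfpos w), ← Real.exp_add, Real.exp_le_exp]
    linarith [(abs_le.1 (hterm w hw)).2]
  have hlower : wordProd c u x * Real.exp (τ * Real.log δ - e)
      ≤ ∑ w ∈ T, μ.real (E w) ^ q := by
    rw [← hsum, Finset.sum_mul]
    refine Finset.sum_le_sum fun w hw => ?_
    rw [hrpow, ← Real.exp_log (hfpos w), ← Real.exp_add, Real.exp_le_exp]
    linarith [(abs_le.1 (hterm w hw)).1]
  have hpos : 0 < wordProd c u x * Real.exp (τ * Real.log δ - e) :=
    mul_pos (hfpos u) (Real.exp_pos _)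
  have l1 := Real.log_le_log hpos hlower
  have l2 := Real.log_le_log (hpos.trans_le hlower) hupper
  rw [Real.log_mul (hfpos u).ne' (Real.exp_pos _).ne', Real.log_exp] at l1 l2
  have l3 := neg_abs_le (Real.log (wordProd c u x))
  have l4 := le_abs_self (Real.log (wordProd c u x))
  rw [abs_le]
  constructor <;> linarith

/-- `log f(δ) / log δ` has lower limit at most `τ + 2ε` if `f(δ) ≥ e^{-K} δ^{τ + ε}`. -/
theorem liminf_log_div_log_le {f : ℝ → ℝ≥0∞} {τ ε K : ℝ} (hε : 0 < ε)
    (h : ∀ᶠ δ in 𝓝[>] (0 : ℝ),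
      ENNReal.ofReal (Real.exp (τ * Real.log δ - (K + ε * -Real.log δ))) ≤ f δ) :
    liminf (fun δ : ℝ => ENNReal.log (f δ) / ((Real.log δ : ℝ) : EReal)) (𝓝[>] 0)
      ≤ ((τ + 2 * ε : ℝ) : EReal) := by
  refine (liminf_le_liminf ?_).trans_eq (liminf_const (f := 𝓝[>] (0 : ℝ)) _)
  have h1 := Real.tendsto_log_nhdsGT_zero.eventually_le_atBot (-(|K| / ε))
  have h2 : ∀ᶠ δ : ℝ in 𝓝[>] 0, δ ∈ Ioo (0 : ℝ) 1 := Ioo_mem_nhdsGT one_pos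
  filter_upwards [h, h1, h2] with δ hδ hK h01
  have hlog := Real.log_neg h01.1 h01.2
  have h3 := ENNReal.log_monotone hδ
  rw [ENNReal.log_ofReal_of_pos (Real.exp_pos _), Real.log_exp] at h3
  refine (EReal.div_le_div_right_of_nonpos (by exact_mod_cast hlog.le) h3).trans ?_
  rw [← EReal.coe_div, EReal.coe_le_coe_iff, div_le_iff_of_neg hlog]
  have h4 : |K| ≤ ε * -Real.log δ := by
    rw [mul_comm, ← div_le_iff₀ hε]; linarith
  linarith [le_abs_self K]

/-- `log f(δ) / log δ` has lower limit at least `τ - 2ε` if `f(δ) ≤ e^K δ^{τ - ε}`. -/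
theorem le_liminf_log_div_log {f : ℝ → ℝ≥0∞} {τ ε K : ℝ} (hε : 0 < ε)
    (h : ∀ᶠ δ in 𝓝[>] (0 : ℝ),
      f δ ≤ ENNReal.ofReal (Real.exp (τ * Real.log δ + (K + ε * -Real.log δ)))) :
    ((τ - 2 * ε : ℝ) : EReal)
      ≤ liminf (fun δ : ℝ => ENNReal.log (f δ) / ((Real.log δ : ℝ) : EReal)) (𝓝[>] 0) := by
  refine (liminf_const (f := 𝓝[>] (0 : ℝ)) _).symm.trans_le (liminf_le_liminf ?_)
  have h1 := Real.tendsto_log_nhdsGT_zero.eventually_le_atBot (-(|K| / ε))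
  have h2 : ∀ᶠ δ : ℝ in 𝓝[>] 0, δ ∈ Ioo (0 : ℝ) 1 := Ioo_mem_nhdsGT one_pos
  filter_upwards [h, h1, h2] with δ hδ hK h01
  have hlog := Real.log_neg h01.1 h01.2
  have h3 := ENNReal.log_monotone hδ
  rw [ENNReal.log_ofReal_of_pos (Real.exp_pos _), Real.log_exp] at h3
  refine le_trans ?_ (EReal.div_le_div_right_of_nonpos (by exact_mod_cast hlog.le) h3)
  rw [← EReal.coe_div, EReal.coe_le_coe_iff, le_div_iff_of_neg hlog]
  have h4 : |K| ≤ ε * -Real.log δ := by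
    rw [mul_comm, ← div_le_iff₀ hε]; linarith
  linarith [le_abs_self K]

theorem HasLimitWeights.lqSpectrum_eq [SecondCountableTopology X]
    [IsProbabilityMeasure μ] (hX : IsDoubling X) (hE : IsMoranConstruction E r)
    (hμ : HasLimitWeights μ E p) {q τ : ℝ} (hq : 0 ≤ q) {x : X} (hx : x ∈ limitSet E)
    (hτ : ∑ i, p i x ^ q * r i x ^ (-τ) = 1) : lqSpectrum μ q x = (τ : EReal) := by
  obtain ⟨C, hC1, hC⟩ := hE.exists_diam_le_mul
  have hC0 : 0 < C := one_pos.trans_le hC1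
  have hcut : ∀ u : List (Fin m), ∀ᶠ δ in 𝓝[>] (0 : ℝ), 0 < δ ∧ ∃ T, IsCut E C u δ T := fun u => by
    have h0 : 0 < C * Metric.diam (E u) := mul_pos hC0 (hE.diam_pos u)
    filter_upwards [Ioo_mem_nhdsGT h0] with δ hδ
    exact ⟨hδ.1, hE.exists_isCut hC hδ.1 hδ.2.le⟩
  have hsumR : ∀ T : Finset (List (Fin m)), ∑ w ∈ T, μ (E w) ^ q
      = ENNReal.ofReal (∑ w ∈ T, μ.real (E w) ^ q) := fun T => by
    rw [ENNReal.ofReal_sum_of_nonneg fun w _ => Real.rpow_nonneg measureReal_nonneg _]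
    refine Finset.sum_congr rfl fun w _ => ?_
    rw [← ENNReal.ofReal_rpow_of_pos (hμ.measureReal_pos hE w), ofReal_measureReal]
  have hTpos : ∀ {u δ T}, IsCut E C u δ T → 0 < ∑ w ∈ T, μ.real (E w) ^ q := fun {u δ T} hT => by
    obtain ⟨z, hz, hzu⟩ := hE.exists_mem_limitSet u
    obtain ⟨w, hw, -⟩ := hT.cover z hz hzu
    exact Finset.sum_pos (fun w _ => Real.rpow_pos_of_pos (hμ.measureReal_pos hE w) _) ⟨w, hw⟩
  have hle : ∀ ε > 0, lqSpectrum μ q x ≤ ((τ + 2 * ε : ℝ) : EReal) := fun ε hε => by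
    obtain ⟨N₀, hN₀⟩ := hμ.exists_abs_log_sum_sub_le hE hC0 hq hx hτ hε
    obtain ⟨M, hM⟩ := hμ.exists_sum_le_packingSum hX hE hC0 hq
    refine le_of_tendsto (tendsto_lqSpectrum μ q x) ?_
    filter_upwards [self_mem_nhdsWithin] with ρ (hρ : 0 < ρ)
    obtain ⟨N₁, hN₁⟩ := hE.exists_subset_closedBall hx hρ
    obtain ⟨K, hK⟩ := hN₀ (max N₀ N₁) (le_max_left _ _)
    refine liminf_log_div_log_le (K := K + Real.log (M + 1)) hε ?_
    filter_upwards [hcut (word E x (max N₀ N₁))] with δ hδ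
    obtain ⟨hδ, T, hT⟩ := hδ
    have h1 := hM _ δ T x ρ hδ hT (hN₁ _ (le_max_right _ _))
    have h2 := (abs_le.1 (hK δ T hδ hT)).1
    have hM1 : (0 : ℝ) < M + 1 := by positivity
    have h3 : ENNReal.ofReal (∑ w ∈ T, μ.real (E w) ^ q)
        ≤ ENNReal.ofReal (M + 1) * packingSum μ q δ ρ x := by
      rw [← hsumR]
      refine h1.trans (mul_le_mul_left ?_ _)
      rw [← ENNReal.ofReal_natCast]
      exact ENNReal.ofReal_le_ofReal (by linarith)
    have h4 : Real.exp (τ * Real.log δ - (K + Real.log (M + 1) + ε * -Real.log δ)) * (M + 1)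
        ≤ ∑ w ∈ T, μ.real (E w) ^ q := by
      rw [← Real.exp_log hM1, ← Real.exp_add, ← Real.exp_log (hTpos hT), Real.exp_le_exp,
        Real.log_exp]
      linarith
    have h5 := (ENNReal.ofReal_le_ofReal h4).trans h3
    rw [ENNReal.ofReal_mul (Real.exp_pos _).le, mul_comm] at h5
    exact (ENNReal.mul_le_mul_iff_right (by simpa using hM1) ENNReal.ofReal_ne_top).1 h5
  have hge : ∀ ε > 0, ((τ - 2 * ε : ℝ) : EReal) ≤ lqSpectrum μ q x := fun ε hε => by
    obtain ⟨N₀, hN₀⟩ := hμ.exists_abs_log_sum_sub_le hE hC0 hq hx hτ hε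
    obtain ⟨M, hM0, hM⟩ := hμ.exists_packingSum_le_sum hX hE hC0 hq
    obtain ⟨K, hK⟩ := hN₀ N₀ le_rfl
    obtain ⟨ρ₀, hρ₀, hsub⟩ := hE.exists_closedBall_inter_subset (hE.mem_word hx N₀)
    refine ge_of_tendsto (tendsto_lqSpectrum μ q x) ?_
    filter_upwards [Ioo_mem_nhdsGT (half_pos hρ₀)] with ρ hρ
    refine le_liminf_log_div_log (K := K + Real.log M) hε ?_
    filter_upwards [hcut (word E x N₀), Ioo_mem_nhdsGT (half_pos hρ₀)] with δ hδ hδ2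
    obtain ⟨hδ, T, hT⟩ := hδ
    refine (hM _ δ T x ρ hδ hT ((inter_subset_inter_left _
      (Metric.closedBall_subset_closedBall (by linarith [hρ.2, hδ2.2]))).trans hsub)).trans ?_
    have h2 := (abs_le.1 (hK δ T hδ hT)).2
    rw [hsumR, ← ENNReal.ofReal_mul hM0.le]
    refine ENNReal.ofReal_le_ofReal ?_
    rw [← Real.exp_log hM0, ← Real.exp_log (hTpos hT), ← Real.exp_add, Real.exp_le_exp,
      Real.log_exp]
    linarith
  have hlim : ∀ s : ℝ, Tendsto (fun ε : ℝ => ((τ + s * ε : ℝ) : EReal)) (𝓝[>] 0) (𝓝 (τ : EReal)) :=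
    fun s => by
      refine (continuous_coe_real_ereal.tendsto τ).comp ?_
      have : Tendsto (fun ε : ℝ => τ + s * ε) (𝓝 0) (𝓝 (τ + s * 0)) :=
        (Continuous.tendsto (by fun_prop) 0)
      simpa using this.mono_left nhdsWithin_le_nhds
  refine le_antisymm (ge_of_tendsto (hlim 2) ?_) (le_of_tendsto (hlim (-2)) ?_)
  · filter_upwards [self_mem_nhdsWithin] with ε hε using hle ε hε
  · filter_upwards [self_mem_nhdsWithin] with ε hε
    convert hge ε hε using 2
    ring

/-- The equation `∑ a_i b_i^{-τ} = 1` has exactly one solution when `a_i > 0`, `0 < b_i < 1`. -/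
theorem existsUnique_sum_mul_rpow_eq_one {ι : Type*} [Fintype ι] [Nonempty ι] {a b : ι → ℝ}
    (ha : ∀ i, 0 < a i) (hb : ∀ i, b i ∈ Ioo (0 : ℝ) 1) :
    ∃! τ : ℝ, ∑ i, a i * b i ^ (-τ) = 1 := by
  have hmono : StrictMono fun τ : ℝ => ∑ i, a i * b i ^ (-τ) := fun s t hst => by
    refine Finset.sum_lt_sum_of_nonempty Finset.univ_nonempty fun i _ => ?_
    exact mul_lt_mul_of_pos_left
      (Real.rpow_lt_rpow_of_exponent_gt (hb i).1 (hb i).2 (by linarith)) (ha i)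
  have hcont : Continuous fun τ : ℝ => ∑ i, a i * b i ^ (-τ) := by
    refine continuous_finsetSum _ fun i _ => continuous_const.mul ?_
    exact (Real.continuous_const_rpow (hb i).1.ne').comp continuous_neg
  have hbot : Tendsto (fun τ : ℝ => ∑ i, a i * b i ^ (-τ)) atBot (𝓝 0) := by
    have h : ∀ i ∈ Finset.univ, Tendsto (fun τ : ℝ => a i * b i ^ (-τ)) atBot (𝓝 0) := fun i _ => by
      have h1 := tendsto_rpow_atTop_of_base_lt_one (b i) (by linarith [(hb i).1]) (hb i).2
      simpa using (h1.comp tendsto_neg_atBot_atTop).const_mul (a i)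
    simpa using tendsto_finsetSum _ h
  have htop : Tendsto (fun τ : ℝ => ∑ i, a i * b i ^ (-τ)) atTop atTop := by
    let i₀ : ι := Classical.arbitrary ι
    have h1 := tendsto_rpow_atBot_of_base_lt_one (b i₀) (hb i₀).1 (hb i₀).2
    refine tendsto_atTop_mono (fun τ => ?_)
      ((h1.comp tendsto_neg_atTop_atBot).const_mul_atTop (ha i₀))
    exact Finset.single_le_sum (f := fun i => a i * b i ^ (-τ)) (fun i _ =>
      (mul_pos (ha i) (Real.rpow_pos_of_pos (hb i).1 _)).le) (Finset.mem_univ i₀)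
  obtain ⟨s, hs⟩ := (hbot.eventually (gt_mem_nhds one_pos)).exists
  obtain ⟨t, ht⟩ := (htop.eventually_ge_atTop 1).exists
  obtain ⟨τ, hτ⟩ := mem_range_of_exists_le_of_exists_ge hcont ⟨s, hs.le⟩ ⟨t, ht⟩
  exact ⟨τ, hτ, fun τ' h => hmono.injective (h.trans hτ.symm)⟩

end Lq

/-! ### Frequencies of letters along typical codes -/

section Drift

variable {X : Type*} [MeasurableSpace X] {m : ℕ} {E : List (Fin m) → Set X} {μ : Measure X}

/-- The sum of the weights of the letter `j` along the prefixes of a word: the compensator of the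
number of occurrences of `j`. -/
def drift (μ : Measure X) (E : List (Fin m) → Set X) (j : Fin m) (w : List (Fin m)) : ℝ :=
  ∑ k ∈ Finset.range w.length, weight μ E (w.take k) j

theorem drift_append (j : Fin m) (w : List (Fin m)) (i : Fin m) :
    drift μ E j (w ++ [i]) = drift μ E j w + weight μ E w j := by
  rw [drift, drift, List.length_append, List.length_singleton, Finset.sum_range_succ]
  congr 1
  · refine Finset.sum_congr rfl fun k hk => ?_
    rw [List.take_append_of_le_length (Finset.mem_range.1 hk).le]
  · rw [List.take_left]

end Drift

section Frequencies

variable {X : Type*} [MetricSpace X] [MeasurableSpace X] {m : ℕ} {E : List (Fin m) → Set X}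
  {r p : Fin m → X → ℝ} {μ : Measure X}

/-- A form of the Borel–Cantelli lemma for step functions on construction sets. -/
theorem IsMoranConstruction.ae_eventually_le_one [BorelSpace X] (hE : IsMoranConstruction E r)
    (S : ℕ → Finset (List (Fin m))) (g : ℕ → List (Fin m) → ℝ≥0∞)
    (hsum : ∑' n, ∑ w ∈ S n, g n w * μ (E w) ≠ ∞) :
    ∀ᵐ x ∂μ, ∀ᶠ n in atTop, ∀ w ∈ S n, x ∈ E w → g n w ≤ 1 := by
  set h : ℕ → X → ℝ≥0∞ := fun n x => ∑ w ∈ S n, (E w).indicator (fun _ => g n w) x with hh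
  have hmeas : ∀ n, Measurable (h n) := fun n =>
    Finset.measurable_fun_sum _ fun w _ => measurable_const.indicator (hE.measurableSet w)
  have hint : ∀ n, ∫⁻ x, h n x ∂μ = ∑ w ∈ S n, g n w * μ (E w) := fun n => by
    rw [hh, lintegral_finsetSum _ fun w _ => measurable_const.indicator (hE.measurableSet w)]
    exact Finset.sum_congr rfl fun w _ => lintegral_indicator_const (hE.measurableSet w) _
  have h1 : ∫⁻ x, ∑' n, h n x ∂μ ≠ ∞ := by
    rw [lintegral_tsum fun n => (hmeas n).aemeasurable]
    simpa only [hint] using hsum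
  filter_upwards [ae_lt_top (Measurable.tsum hmeas) h1] with x hx
  have h2 := ENNReal.tendsto_atTop_zero_of_tsum_ne_top hx.ne
  filter_upwards [h2.eventually (gt_mem_nhds one_pos)] with n hn w hw hxw
  refine le_trans ?_ hn.le
  have h3 := Finset.single_le_sum (f := fun w => (E w).indicator (fun _ => g n w) x)
    (fun _ _ => zero_le) hw
  simpa [indicator_of_mem hxw] using h3

/-- The words of length `n`. -/
def levelWords (m n : ℕ) : Finset (List (Fin m)) := (List.finite_length_eq (Fin m) n).toFinset

theorem mem_levelWords {n : ℕ} {w : List (Fin m)} : w ∈ levelWords m n ↔ w.length = n := by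
  simp [levelWords]

theorem sum_levelWords_succ (f : List (Fin m) → ℝ) (n : ℕ) :
    ∑ w ∈ levelWords m (n + 1), f w = ∑ w ∈ levelWords m n, ∑ i, f (w ++ [i]) := by
  have h : levelWords m (n + 1)
      = (levelWords m n ×ˢ (Finset.univ : Finset (Fin m))).image fun z => z.1 ++ [z.2] := by
    ext w
    simp only [mem_levelWords, Finset.mem_image, Finset.mem_product, Finset.mem_univ, and_true,
      Prod.exists]
    constructor
    · intro hw
      rcases List.eq_nil_or_concat w with rfl | ⟨v, i, rfl⟩
      · simp at hw
      · exact ⟨v, i, by simpa using hw, List.concat_eq_append.symm⟩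
    · rintro ⟨v, i, hv, rfl⟩
      simp [hv]
  rw [h, Finset.sum_image, Finset.sum_product]
  rintro ⟨v, i⟩ - ⟨w, j⟩ - hvw
  have := List.append_inj' hvw rfl
  simpa using this

variable [Nonempty (Fin m)] [SecondCountableTopology X] [BorelSpace X] [IsProbabilityMeasure μ]

/-- The exponential moment bound for the compensated number of occurrences of the letter `j`. -/
theorem HasLimitWeights.sum_levelWords_exp_le (hE : IsMoranConstruction E r)
    (hμ : HasLimitWeights μ E p) (j : Fin m) {l : ℝ} (hl : |l| ≤ 1) (n : ℕ) :
    ∑ w ∈ levelWords m n, Real.exp (l * (w.count j - drift μ E j w)) * μ.real (E w)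
      ≤ Real.exp (l ^ 2 * n) := by
  induction n with
  | zero =>
    have : levelWords m 0 = {[]} := by ext w; simp [mem_levelWords]
    simp [this, drift, measureReal_le_one]
  | succ n ih =>
    have hstep : ∀ w, ∑ i, Real.exp (l * ((w ++ [i]).count j - drift μ E j (w ++ [i])))
        * μ.real (E (w ++ [i]))
        ≤ Real.exp (l ^ 2) * (Real.exp (l * (w.count j - drift μ E j w)) * μ.real (E w)) :=
      fun w => by
        set t : Fin m → ℝ := fun i => l * ((if i = j then 1 else 0) - weight μ E w j) with ht
        have h0 := hμ.weight_pos hE w j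
        have h1 := hμ.weight_le_one hE w j
        have hsq : ∀ i, t i ^ 2 ≤ l ^ 2 := fun i => by
          have h2 : ((if i = j then 1 else 0) - weight μ E w j) ^ 2 ≤ 1 := by
            split_ifs <;> nlinarith
          rw [ht, mul_pow]
          exact mul_le_of_le_one_right (sq_nonneg _) h2
        have hexp : ∀ i, Real.exp (t i) ≤ 1 + t i + l ^ 2 := fun i => by
          have h2 : |t i| ≤ 1 := by
            rw [← sq_le_one_iff_abs_le_one]
            exact (hsq i).trans ((sq_le_one_iff_abs_le_one _).2 hl)
          have h3 := (abs_le.1 (Real.abs_exp_sub_one_sub_id_le h2)).2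
          linarith [hsq i]
        -- The increment has conditional mean zero.
        have hmean : ∑ i, weight μ E w i * t i = 0 := by
          have h2 : ∀ i, weight μ E w i * t i
              = l * ((if i = j then weight μ E w i else 0) - weight μ E w j * weight μ E w i) :=
            fun i => by simp only [ht]; split_ifs <;> ring
          simp only [h2]
          rw [← Finset.mul_sum, Finset.sum_sub_distrib, ← Finset.mul_sum, hμ.sum_weight hE]
          simp
        have hw : ∑ i, weight μ E w i * Real.exp (t i) ≤ Real.exp (l ^ 2) := by
          calc ∑ i, weight μ E w i * Real.exp (t i)
              ≤ ∑ i, weight μ E w i * (1 + t i + l ^ 2) := by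
                gcongr with i
                · exact (hμ.weight_pos hE w i).le
                · exact hexp i
            _ = ∑ i, (weight μ E w i * t i + weight μ E w i * (1 + l ^ 2)) :=
                Finset.sum_congr rfl fun i _ => by ring
            _ = l ^ 2 + 1 := by
                rw [Finset.sum_add_distrib, hmean, ← Finset.sum_mul, hμ.sum_weight hE]; ring
            _ ≤ Real.exp (l ^ 2) := Real.add_one_le_exp _
        calc _ = ∑ i, (weight μ E w i * Real.exp (t i))
                * (Real.exp (l * (w.count j - drift μ E j w)) * μ.real (E w)) := by
              refine Finset.sum_congr rfl fun i _ => ?_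
              rw [drift_append, hμ.measureReal_append hE, List.count_append,
                List.count_singleton]
              have h2 : l * (((w.count j + if i == j then 1 else 0 : ℕ) : ℝ)
                  - (drift μ E j w + weight μ E w j))
                  = t i + l * (w.count j - drift μ E j w) := by
                simp only [ht, beq_iff_eq]; push_cast; ring
              rw [h2, Real.exp_add]
              ring
          _ ≤ _ := by
              rw [← Finset.sum_mul]
              gcongr
    rw [sum_levelWords_succ]
    calc _ ≤ ∑ w ∈ levelWords m n, Real.exp (l ^ 2)
          * (Real.exp (l * (w.count j - drift μ E j w)) * μ.real (E w)) :=
          Finset.sum_le_sum fun w _ => hstep w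
      _ ≤ Real.exp (l ^ 2) * Real.exp (l ^ 2 * n) := by
          rw [← Finset.mul_sum]
          gcongr
      _ = Real.exp (l ^ 2 * (n + 1 : ℕ)) := by
          rw [← Real.exp_add]; congr 1; push_cast; ring

theorem HasLimitWeights.ae_eventually_mul_count_sub_drift_le (hE : IsMoranConstruction E r)
    (hμ : HasLimitWeights μ E p) (j : Fin m) {l : ℝ} (hl : |l| ≤ 1) (hl0 : l ≠ 0) :
    ∀ᵐ x ∂μ, ∀ᶠ n : ℕ in atTop,
      l * ((word E x n).count j - drift μ E j (word E x n)) ≤ 2 * l ^ 2 * n := by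
  have hsum : ∑' n : ℕ, ∑ w ∈ levelWords m n,
      ENNReal.ofReal (Real.exp (l * (w.count j - drift μ E j w) - 2 * l ^ 2 * n)) * μ (E w)
        ≠ ∞ := by
    have h1 : ∀ n : ℕ, ∑ w ∈ levelWords m n,
        ENNReal.ofReal (Real.exp (l * (w.count j - drift μ E j w) - 2 * l ^ 2 * n)) * μ (E w)
        ≤ ENNReal.ofReal (Real.exp (-l ^ 2) ^ n) := fun n => by
      have h2 : ∀ w, ENNReal.ofReal (Real.exp (l * (w.count j - drift μ E j w) - 2 * l ^ 2 * n))
          * μ (E w) = ENNReal.ofReal (Real.exp (-(2 * l ^ 2 * n))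
            * (Real.exp (l * (w.count j - drift μ E j w)) * μ.real (E w))) := fun w => by
        rw [← mul_assoc, ← Real.exp_add, neg_add_eq_sub, ENNReal.ofReal_mul (Real.exp_pos _).le,
          ofReal_measureReal]
      rw [Finset.sum_congr rfl fun w _ => h2 w,
        ← ENNReal.ofReal_sum_of_nonneg fun w _ => by positivity, ← Finset.mul_sum]
      refine ENNReal.ofReal_le_ofReal ?_
      calc _ ≤ Real.exp (-(2 * l ^ 2 * n)) * Real.exp (l ^ 2 * n) := by
            gcongr; exact hμ.sum_levelWords_exp_le hE j hl n
        _ = Real.exp (-l ^ 2) ^ n := by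
            rw [← Real.exp_add, ← Real.exp_nat_mul]; congr 1; ring
    refine ne_top_of_le_ne_top ?_ (ENNReal.tsum_le_tsum h1)
    refine (summable_geometric_of_lt_one (Real.exp_pos _).le ?_).tsum_ofReal_ne_top
    rw [Real.exp_lt_one_iff]
    have : 0 < l ^ 2 := by positivity
    linarith
  filter_upwards [hE.ae_eventually_le_one _ _ hsum, hμ.ae_mem] with x hx hxA
  filter_upwards [hx] with n hn
  have h1 := hn (word E x n) (mem_levelWords.2 (by simp)) (hE.mem_word hxA n)
  rw [ENNReal.ofReal_le_one, Real.exp_le_one_iff] at h1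
  linarith

theorem HasLimitWeights.ae_tendsto_count_sub_drift_div (hE : IsMoranConstruction E r)
    (hμ : HasLimitWeights μ E p) (j : Fin m) :
    ∀ᵐ x ∂μ, Tendsto (fun n : ℕ =>
      (((word E x n).count j : ℝ) - drift μ E j (word E x n)) / n) atTop (𝓝 0) := by
  have h1 : ∀ k : ℕ, ∀ᵐ x ∂μ, ∀ᶠ n : ℕ in atTop,
      |((word E x n).count j : ℝ) - drift μ E j (word E x n)| ≤ 2 * (1 / (k + 1 : ℝ)) * n := by
    intro k
    have hpos : (0 : ℝ) < 1 / (k + 1 : ℝ) := by positivity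
    have hle : |1 / (k + 1 : ℝ)| ≤ 1 := by
      rw [abs_of_pos hpos, div_le_one (by positivity)]
      linarith [(Nat.cast_nonneg k : (0 : ℝ) ≤ k)]
    generalize 1 / (k + 1 : ℝ) = l at hpos hle
    filter_upwards [hμ.ae_eventually_mul_count_sub_drift_le hE j hle hpos.ne',
      hμ.ae_eventually_mul_count_sub_drift_le hE j (l := -l) (by rwa [abs_neg])
        (neg_ne_zero.2 hpos.ne')] with x hx1 hx2
    filter_upwards [hx1, hx2] with n hn1 hn2
    generalize ((word E x n).count j : ℝ) - drift μ E j (word E x n) = c at hn1 hn2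
    refine abs_le'.2 ⟨le_of_mul_le_mul_left ?_ hpos, le_of_mul_le_mul_left ?_ hpos⟩ <;> linarith
  filter_upwards [ae_all_iff.2 h1] with x hx
  rw [Metric.tendsto_atTop']
  intro ε hε
  obtain ⟨k, hk⟩ := exists_nat_one_div_lt (half_pos hε)
  obtain ⟨N, hN⟩ := eventually_atTop.1 (hx k)
  refine ⟨N, fun n hn => ?_⟩
  have hn0 : (0 : ℝ) < n := by exact_mod_cast (Nat.zero_le N).trans_lt hn
  rw [Real.dist_0_eq_abs, abs_div, abs_of_pos hn0, div_lt_iff₀ hn0]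
  refine (hN n hn.le).trans_lt ?_
  gcongr
  linarith

/-- Along almost every code the letter `j` occurs with frequency `p_j` at the coded point. -/
theorem HasLimitWeights.ae_tendsto_count_div (hE : IsMoranConstruction E r)
    (hμ : HasLimitWeights μ E p) :
    ∀ᵐ x ∂μ, ∀ j, Tendsto (fun n : ℕ => ((word E x n).count j : ℝ) / n) atTop (𝓝 (p j x)) := by
  filter_upwards [ae_all_iff.2 fun j => hμ.ae_tendsto_count_sub_drift_div hE j, hμ.ae_mem]
    with x hx hxA j
  have hdrift : ∀ n, drift μ E j (word E x n) = ∑ k ∈ Finset.range n, weight μ E (word E x k) j :=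
    fun n => by
      rw [drift, length_word]
      refine Finset.sum_congr rfl fun k hk => ?_
      have := List.prefix_iff_eq_take.1 (word_prefix (E := E) x (Finset.mem_range.1 hk).le)
      rw [length_word] at this
      rw [← this]
  have hw : Tendsto (fun n => weight μ E (word E x n) j) atTop (𝓝 (p j x)) := by
    refine Metric.tendsto_atTop.2 fun ε hε => ?_
    obtain ⟨N, hN⟩ := hμ.exists_abs_weight_sub_lt hE hε
    exact ⟨N, fun n hn => hN _ (by simpa using hn) x hxA (hE.mem_word hxA n) j⟩
  have hsum := (hx j).add hw.cesaro
  rw [zero_add] at hsum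
  refine hsum.congr fun n => ?_
  rw [← hdrift n]
  ring

theorem tendsto_div_of_abs_sub_le {a b : ℕ → ℝ} {L : ℝ}
    (ha : Tendsto (fun n : ℕ => a n / n) atTop (𝓝 L))
    (h : ∀ ε > 0, ∃ N K, ∀ n : ℕ, N ≤ n → |b n - a n| ≤ K + ε * n) :
    Tendsto (fun n : ℕ => b n / n) atTop (𝓝 L) := by
  have hd : Tendsto (fun n : ℕ => (b n - a n) / n) atTop (𝓝 0) := by
    rw [Metric.tendsto_atTop']
    intro ε hε
    obtain ⟨N, K, hK⟩ := h (ε / 2) (half_pos hε)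
    obtain ⟨N', hN'⟩ := exists_nat_gt (K / (ε / 2))
    refine ⟨max N N', fun n hn => ?_⟩
    have hn0 : (0 : ℝ) < n := by exact_mod_cast (Nat.zero_le _).trans_lt hn
    rw [Real.dist_0_eq_abs, abs_div, abs_of_pos hn0, div_lt_iff₀ hn0]
    refine (hK n ((le_max_left _ _).trans hn.le)).trans_lt ?_
    have h1 : (N' : ℝ) ≤ n := by exact_mod_cast (le_max_right _ _).trans hn.le
    have h2 := (div_lt_iff₀ (half_pos hε)).1 (hN'.trans_le h1)
    linarith
  have := hd.add ha
  rw [zero_add] at this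
  exact this.congr fun n => by ring

/-- The logarithmic growth rates of the measure and the diameter along almost every code. -/
theorem HasLimitWeights.ae_tendsto_log_div (hE : IsMoranConstruction E r)
    (hμ : HasLimitWeights μ E p) :
    ∀ᵐ x ∂μ, Tendsto (fun n : ℕ => Real.log (μ.real (E (word E x n))) / n) atTop
        (𝓝 (∑ i, p i x * Real.log (p i x))) ∧
      Tendsto (fun n : ℕ => Real.log (Metric.diam (E (word E x n))) / n) atTop
        (𝓝 (∑ i, p i x * Real.log (r i x))) := by
  filter_upwards [hμ.ae_tendsto_count_div hE, hμ.ae_mem] with x hx hxA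
  have hg : ∀ g : Fin m → ℝ, Tendsto (fun n : ℕ => ((word E x n).map g).sum / n) atTop
      (𝓝 (∑ i, p i x * g i)) := fun g => by
    refine (tendsto_finsetSum Finset.univ fun i _ => (hx i).mul_const (g i)).congr fun n => ?_
    rw [sum_map_eq_sum_count, Finset.sum_div]
    exact Finset.sum_congr rfl fun i _ => by ring
  constructor
  · refine tendsto_div_of_abs_sub_le (hg _) fun ε hε => ?_
    obtain ⟨N, K, h⟩ := hμ.exists_abs_log_measureReal_sub_sum_le hE hxA hε
    exact ⟨N, K, fun n hn => by simpa using h _ (word_prefix x hn)⟩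
  · refine tendsto_div_of_abs_sub_le (hg _) fun ε hε => ?_
    obtain ⟨N, h⟩ := hE.exists_abs_log_diam_sub_sum_le hxA hε
    exact ⟨N, 0, fun n hn => by simpa using h _ (word_prefix x hn)⟩

end Frequencies

/-! ### The local dimension -/

section LocalDimension

variable {X : Type*} [MetricSpace X] [MeasurableSpace X] {m : ℕ} {E : List (Fin m) → Set X}
  {r p : Fin m → X → ℝ} {μ : Measure X}

theorem tendsto_div_log_of_abs_sub_le {f : ℝ → ℝ} {s : ℝ}
    (h : ∀ ε > 0, ∃ K, ∀ᶠ δ in 𝓝[>] (0 : ℝ), |f δ - s * Real.log δ| ≤ K + ε * -Real.log δ) :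
    Tendsto (fun δ => f δ / Real.log δ) (𝓝[>] 0) (𝓝 s) := by
  rw [Metric.tendsto_nhds]
  intro ε hε
  obtain ⟨K, hK⟩ := h (ε / 2) (half_pos hε)
  have h1 := Real.tendsto_log_nhdsGT_zero.eventually_lt_atBot (-(|K| / (ε / 2)))
  filter_upwards [hK, h1] with δ hδ h1
  have hlog : Real.log δ < 0 := h1.trans_le (neg_nonpos.2 (by positivity))
  have h2 : |K| < ε / 2 * -Real.log δ := by
    rw [mul_comm, ← div_lt_iff₀ (half_pos hε)]; linarith
  rw [Real.dist_eq, show f δ / Real.log δ - s = (f δ - s * Real.log δ) / Real.log δ by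
    rw [sub_div, mul_div_cancel_right₀ _ hlog.ne], abs_div, abs_of_neg hlog,
    div_lt_iff₀ (neg_pos.2 hlog)]
  linarith [le_abs_self K]

/-- A point of `E_w` sees, in the ball of radius `diam E_w`, at least the mass of `E_w`. -/
theorem IsMoranConstruction.measureReal_le_closedBall [IsProbabilityMeasure μ]
    (hE : IsMoranConstruction E r) {w : List (Fin m)} {x : X} {δ : ℝ} (hxw : x ∈ E w)
    (hd : Metric.diam (E w) ≤ δ) : μ.real (E w) ≤ μ.real (Metric.closedBall x δ) :=
  measureReal_mono fun _ hz =>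
    (Metric.dist_le_diam_of_mem (hE.isCompact w).isBounded hz hxw).trans hd

theorem HasLimitWeights.hasLocalDim_of_tendsto [IsProbabilityMeasure μ]
    (hμ : HasLimitWeights μ E p) {x : X}
    (hx : x ∈ limitSet E) {s : ℝ}
    (h : Tendsto (fun δ => Real.log (μ.real (Metric.closedBall x δ)) / Real.log δ) (𝓝[>] 0)
      (𝓝 s)) : HasLocalDim μ x (s : EReal) := by
  have h1 : Tendsto (fun δ : ℝ => ENNReal.log (μ (Metric.closedBall x δ))
      / ((Real.log δ : ℝ) : EReal)) (𝓝[>] 0) (𝓝 (s : EReal)) := by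
    refine ((continuous_coe_real_ereal.tendsto s).comp h).congr' ?_
    filter_upwards [self_mem_nhdsWithin] with δ (hδ : 0 < δ)
    have h2 : 0 < μ (Metric.closedBall x δ) := (Measure.mem_support_iff_forall x).1
      (hμ.support_eq ▸ hx) _ (Metric.closedBall_mem_nhds x hδ)
    rw [Function.comp_apply, ENNReal.log_pos_real h2.ne' (measure_ne_top _ _), EReal.coe_div]
    rfl
  exact ⟨h1.liminf_eq, h1.limsup_eq⟩

variable [Nontrivial (Fin m)] [SecondCountableTopology X] [BorelSpace X]
  [IsProbabilityMeasure μ]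

/-- For almost every `x` the ball about `x` at a dyadic scale has, up to a small power of the
scale, no more mass than the construction set around `x` at that scale. The total mass, over a
cut, of the neighbourhoods of its members is bounded by the overlap number, so that the members
with a heavy neighbourhood have small total mass. -/
theorem HasLimitWeights.ae_exists_log_closedBall_le (hX : IsDoubling X)
    (hE : IsMoranConstruction E r) (hμ : HasLimitWeights μ E p) {C δ₀ : ℝ} (hC0 : 0 < C)
    (hC : ∀ w i, Metric.diam (E w) ≤ C * Metric.diam (E (w ++ [i]))) (hδ₀ : 0 < δ₀)
    (hδ₀1 : δ₀ ≤ 1) (hδ₀C : δ₀ ≤ C * Metric.diam (E [])) {ε : ℝ} (hε : 0 < ε) :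
    ∀ᵐ x ∂μ, ∀ᶠ k : ℕ in atTop, ∃ n,
      Metric.diam (E (word E x n)) ≤ δ₀ * (1 / 2) ^ k ∧
      δ₀ * (1 / 2) ^ k ≤ C * Metric.diam (E (word E x n)) ∧
      Real.log (μ.real (Metric.closedBall x (δ₀ * (1 / 2) ^ k)))
        ≤ Real.log (μ.real (E (word E x n))) + ε * -Real.log (δ₀ * (1 / 2) ^ k) := by
  classical
  obtain ⟨M, hM⟩ := hE.exists_card_overlap_le hX hC0
  set δ : ℕ → ℝ := fun k => δ₀ * (1 / 2) ^ k with hδdef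
  have hδ : ∀ k, 0 < δ k := fun k => by positivity
  have hδle : ∀ k, δ k ≤ (1 / 2) ^ k := fun k => mul_le_of_le_one_left (by positivity) hδ₀1
  have hδle' : ∀ k, δ k ≤ δ₀ := fun k =>
    mul_le_of_le_one_right hδ₀.le (pow_le_one₀ (by norm_num) (by norm_num))
  choose T hT using fun k => hE.exists_isCut hC (hδ k) ((hδle' k).trans hδ₀C)
  -- `N k w` are the members of the cut within distance `δ k` of `E w`, `Q k w` their total mass.
  set N : ℕ → List (Fin m) → Finset (List (Fin m)) := fun k w =>
    (T k).filter fun w' => ∃ y ∈ E w, ∃ z ∈ E w', dist y z ≤ δ k with hN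
  set Q : ℕ → List (Fin m) → ℝ := fun k w => ∑ w' ∈ N k w, μ.real (E w') with hQ
  have hQ0 : ∀ k w, 0 ≤ Q k w := fun k w => Finset.sum_nonneg fun _ _ => measureReal_nonneg
  have hball : ∀ k w x, x ∈ limitSet E → x ∈ E w → μ.real (Metric.closedBall x (δ k)) ≤ Q k w :=
    fun k w x hx hxw => by
      refine le_trans ?_ (measureReal_biUnion_finset_le (N k w) E)
      refine ENNReal.toReal_mono (measure_ne_top _ _) (measure_mono_ae ?_)
      filter_upwards [hμ.ae_mem] with z hz hzx
      obtain ⟨w', hw', hzw'⟩ := (hT k).cover z hz (by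
        have := hE.mem_word hz 0
        rwa [List.length_eq_zero_iff.1 (length_word z 0)] at this)
      refine mem_iUnion₂.2 ⟨w', Finset.mem_filter.2 ⟨hw', x, hxw, z, hzw', ?_⟩, hzw'⟩
      rw [dist_comm]
      exact hzx
  have hQsum : ∀ k, ∑ w ∈ T k, Q k w ≤ M := fun k => by
    have h1 : ∑ w ∈ T k, Q k w = ∑ w' ∈ T k,
        ∑ w ∈ (T k).filter (fun w => ∃ y ∈ E w, ∃ z ∈ E w', dist y z ≤ δ k), μ.real (E w') := by
      refine Finset.sum_comm' fun w w' => ?_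
      simp only [hN, Finset.mem_filter]
      tauto
    have h2 : ∑ w' ∈ T k, μ.real (E w') ≤ 1 := by
      rw [(hT k).sum_eq (fun w => μ.real (E w)) fun w => hμ.measureReal_eq_sum hE w]
      exact measureReal_le_one
    calc ∑ w ∈ T k, Q k w ≤ ∑ w' ∈ T k, M * μ.real (E w') := by
          rw [h1]
          refine Finset.sum_le_sum fun w' hw' => ?_
          rw [Finset.sum_const, nsmul_eq_mul]
          gcongr
          obtain ⟨y', hy'⟩ := hE.nonempty w'
          refine hM [] (δ k) (T k) (hδ k) (hT k) _ (Finset.filter_subset _ _) y' fun w hw => ?_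
          obtain ⟨y, hy, z, hz, hyz⟩ := (Finset.mem_filter.1 hw).2
          refine ⟨y, hy, ?_⟩
          have h3 := (Metric.dist_le_diam_of_mem (hE.isCompact w').isBounded hz hy').trans
            ((hT k).diam_le w' hw')
          rw [Metric.mem_closedBall]
          linarith [dist_triangle y z y']
      _ ≤ M := by
          rw [← Finset.mul_sum]
          exact mul_le_of_le_one_right (Nat.cast_nonneg _) h2
  have hsum : ∑' k, ∑ w ∈ T k, ENNReal.ofReal (δ k ^ ε * (Q k w / μ.real (E w))) * μ (E w)
      ≠ ∞ := by
    have h1 : ∀ k, ∑ w ∈ T k, ENNReal.ofReal (δ k ^ ε * (Q k w / μ.real (E w))) * μ (E w)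
        ≤ ENNReal.ofReal (((1 / 2 : ℝ) ^ ε) ^ k * M) := fun k => by
      have h2 : ∀ w, ENNReal.ofReal (δ k ^ ε * (Q k w / μ.real (E w))) * μ (E w)
          = ENNReal.ofReal (δ k ^ ε * Q k w) := fun w => by
        rw [← ofReal_measureReal (μ := μ) (s := E w), ← ENNReal.ofReal_mul
          (mul_nonneg (Real.rpow_nonneg (hδ k).le _) (div_nonneg (hQ0 k w) measureReal_nonneg)),
          mul_assoc, div_mul_cancel₀ _ (hμ.measureReal_pos hE w).ne']
      rw [Finset.sum_congr rfl fun w _ => h2 w, ← ENNReal.ofReal_sum_of_nonneg fun w _ =>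
        mul_nonneg (Real.rpow_nonneg (hδ k).le _) (hQ0 k w), ← Finset.mul_sum]
      refine ENNReal.ofReal_le_ofReal (mul_le_mul ?_ (hQsum k)
        (Finset.sum_nonneg fun w _ => hQ0 k w) (by positivity))
      rw [← Real.rpow_natCast, ← Real.rpow_mul (by norm_num), mul_comm ε,
        Real.rpow_mul (by norm_num), Real.rpow_natCast]
      exact Real.rpow_le_rpow (hδ k).le (hδle k) hε.le
    refine ne_top_of_le_ne_top ?_ (ENNReal.tsum_le_tsum h1)
    exact ((summable_geometric_of_lt_one (by positivity)
      (Real.rpow_lt_one (by norm_num) (by norm_num) hε)).mul_right _).tsum_ofReal_ne_top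
  filter_upwards [hE.ae_eventually_le_one _ _ hsum, hμ.ae_mem] with x hx hxA
  filter_upwards [hx] with k hk
  obtain ⟨w, hw, hxw⟩ := (hT k).cover x hxA (by
    have := hE.mem_word hxA 0
    rwa [List.length_eq_zero_iff.1 (length_word x 0)] at this)
  have hword := hE.word_eq hxA hxw
  refine ⟨w.length, ?_⟩
  rw [hword]
  refine ⟨(hT k).diam_le w hw, (hT k).le_mul_diam w hw, ?_⟩
  have h1 := hk w hw hxw
  rw [ENNReal.ofReal_le_one, ← mul_div_assoc, div_le_one (hμ.measureReal_pos hE w)] at h1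
  have h2 : 0 < μ.real (Metric.closedBall x (δ k)) :=
    (hμ.measureReal_pos hE w).trans_le
      (hE.measureReal_le_closedBall hxw ((hT k).diam_le w hw))
  have h3 : δ k ^ ε * μ.real (Metric.closedBall x (δ k)) ≤ μ.real (E w) :=
    (mul_le_mul_of_nonneg_left (hball k w x hxA hxw) (Real.rpow_nonneg (hδ k).le _)).trans h1
  have h4 := Real.log_le_log (mul_pos (Real.rpow_pos_of_pos (hδ k) _) h2) h3
  rw [Real.log_mul (Real.rpow_pos_of_pos (hδ k) _).ne' h2.ne', Real.log_rpow (hδ k)] at h4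
  change Real.log (μ.real (Metric.closedBall x (δ k))) ≤ Real.log (μ.real (E w))
    + ε * -Real.log (δ k)
  linarith

/-- The local dimension of the measure at almost every point is the ratio of the growth rates of
the measures and of the diameters of the construction sets around it. -/
theorem HasLimitWeights.ae_tendsto_log_closedBall_div (hX : IsDoubling X)
    (hE : IsMoranConstruction E r) (hμ : HasLimitWeights μ E p) :
    ∀ᵐ x ∂μ, Tendsto (fun δ => Real.log (μ.real (Metric.closedBall x δ)) / Real.log δ) (𝓝[>] 0)
      (𝓝 ((∑ i, p i x * Real.log (p i x)) / ∑ i, p i x * Real.log (r i x))) := by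
  obtain ⟨C, hC1, hC⟩ := hE.exists_diam_le_mul
  have hC0 : 0 < C := one_pos.trans_le hC1
  obtain ⟨b, hb, K, hK, hlen⟩ := hE.exists_log_diam_le
  obtain ⟨δ₀, hδ₀, hδ₀1, hδ₀C⟩ : ∃ δ₀ : ℝ, 0 < δ₀ ∧ δ₀ ≤ 1 ∧ δ₀ ≤ C * Metric.diam (E []) :=
    ⟨min 1 (C * Metric.diam (E [])), lt_min one_pos (mul_pos hC0 (hE.diam_pos [])),
      min_le_left _ _, min_le_right _ _⟩
  have hdyadic := ae_all_iff.2 fun j : ℕ => hμ.ae_exists_log_closedBall_le hX hE hC0 hC hδ₀ hδ₀1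
    hδ₀C (ε := 1 / (j + 1 : ℝ)) (by positivity)
  filter_upwards [hdyadic, hμ.ae_tendsto_log_div hE, hμ.ae_mem] with x hx hlim hxA
  obtain ⟨ha, hd⟩ := hlim
  set α := ∑ i, p i x * Real.log (p i x) with hα
  set β := ∑ i, p i x * Real.log (r i x) with hβ
  have hβ0 : β < 0 := Finset.sum_neg (fun i _ => mul_neg_of_pos_of_neg (hμ.mem_Ioo i x hxA).1
    (Real.log_neg (hE.ratio_mem i x hxA).1 (hE.ratio_mem i x hxA).2)) Finset.univ_nonempty
  have hα0 : α ≤ 0 := Finset.sum_nonpos fun i _ => mul_nonpos_of_nonneg_of_nonpos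
    (hμ.mem_Ioo i x hxA).1.le (Real.log_neg (hμ.mem_Ioo i x hxA).1 (hμ.mem_Ioo i x hxA).2).le
  set s := α / β with hs
  have hs0 : 0 ≤ s := div_nonneg_of_nonpos hα0 hβ0.le
  set a : ℕ → ℝ := fun n => Real.log (μ.real (E (word E x n)))
  set d : ℕ → ℝ := fun n => Real.log (Metric.diam (E (word E x n)))
  have had : Tendsto (fun n : ℕ => a n / n - s * (d n / n)) atTop (𝓝 0) := by
    have := ha.sub (hd.const_mul s)
    rwa [hs, div_mul_cancel₀ _ hβ0.ne, sub_self] at this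
  have hlogC : 0 ≤ Real.log C := Real.log_nonneg hC1
  -- The relation of the scale to the length of the word.
  have hscale : ∀ n δ, 0 < δ → Metric.diam (E (word E x n)) ≤ δ →
      δ ≤ C * Metric.diam (E (word E x n)) →
      d n ≤ Real.log δ ∧ Real.log δ ≤ Real.log C + d n ∧
        (n : ℝ) ≤ (K + Real.log C - Real.log δ) / b := fun n δ hδ h1 h2 => by
    have hpos := hE.diam_pos (word E x n)
    have h3 := Real.log_le_log hδ h2
    rw [Real.log_mul hC0.ne' hpos.ne'] at h3
    have h4 := hlen (word E x n)
    rw [length_word] at h4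
    refine ⟨Real.log_le_log hpos h1, h3, ?_⟩
    rw [le_div_iff₀ hb]
    linarith
  refine tendsto_div_log_of_abs_sub_le fun ε hε => ?_
  -- The errors from the growth rates and from the comparison of balls are each half of `ε`.
  have hη : 0 < ε / 2 * b := by positivity
  obtain ⟨n₀, hn₀⟩ : ∃ n₀ : ℕ, ∀ n ≥ n₀, |a n - s * d n| ≤ ε / 2 * b * n := by
    obtain ⟨n₀, hn₀⟩ := Metric.tendsto_atTop'.1 had _ hη
    refine ⟨n₀ + 1, fun n hn => ?_⟩
    have hn0 : (0 : ℝ) < n := by exact_mod_cast (Nat.zero_lt_succ _).trans_le hn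
    have h1 := hn₀ n hn
    rw [Real.dist_0_eq_abs, show a n / n - s * (d n / n) = (a n - s * d n) / n by ring, abs_div,
      abs_of_pos hn0, div_lt_iff₀ hn0] at h1
    exact h1.le
  obtain ⟨j, hj⟩ := exists_nat_one_div_lt (half_pos hε)
  obtain ⟨k₀, hk₀⟩ := eventually_atTop.1 (hx j)
  have hlarge : ∀ n δ, δ < Metric.diam (E (word E x n₀)) → Metric.diam (E (word E x n)) ≤ δ →
      n₀ ≤ n := fun n δ h1 h2 => by
    by_contra hlt
    have := hE.diam_mono (word_prefix (E := E) x (not_le.1 hlt).le)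
    linarith
  have hlb : ∀ n ≥ n₀, ∀ L, (n : ℝ) ≤ (K + Real.log C - L) / b →
      |a n - s * d n| ≤ ε / 2 * (K + Real.log C - L) := fun n hn L hL => by
    refine (hn₀ n hn).trans ?_
    calc ε / 2 * b * n ≤ ε / 2 * b * ((K + Real.log C - L) / b) := by gcongr
      _ = ε / 2 * (K + Real.log C - L) := by field_simp
  refine ⟨s * (Real.log C + Real.log 2) + ε / 2 * (K + Real.log C), ?_⟩
  have hev₁ : ∀ᶠ δ : ℝ in 𝓝[>] 0, δ ∈ Ioo 0 (Metric.diam (E (word E x n₀)) / 2) :=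
    Ioo_mem_nhdsGT (half_pos (hE.diam_pos _))
  have hev₂ : ∀ᶠ δ : ℝ in 𝓝[>] 0, δ ∈ Ioo 0 (δ₀ * (1 / 2) ^ (k₀ + 1)) :=
    Ioo_mem_nhdsGT (by positivity)
  filter_upwards [hev₁, hev₂] with δ hδ₁ hδ₂
  have hδ := hδ₁.1
  have hδle : δ ≤ δ₀ := hδ₂.2.le.trans
    (mul_le_of_le_one_right hδ₀.le (pow_le_one₀ (by norm_num) (by norm_num)))
  have hlog2 : 0 ≤ Real.log 2 := Real.log_nonneg (by norm_num)
  rw [abs_le]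
  constructor
  · obtain ⟨n, h1, h2⟩ := hE.exists_word_scale hC hδ (hδle.trans hδ₀C) hxA
    obtain ⟨e1, e2, e3⟩ := hscale n δ hδ h1 h2
    have e4 := hlb n (hlarge n δ (by linarith [hδ₁.2]) h1) _ e3
    have e5 : a n ≤ Real.log (μ.real (Metric.closedBall x δ)) :=
      Real.log_le_log (hμ.measureReal_pos hE _)
        (hE.measureReal_le_closedBall (hE.mem_word hxA n) h1)
    have e6 : s * (Real.log δ - Real.log C) ≤ s * d n := by gcongr; linarith
    have e7 := (abs_le.1 e4).1
    have e8 : 0 ≤ s * Real.log 2 := by positivity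
    have e9 : 0 ≤ ε / 2 * -Real.log δ := by
      have := Real.log_nonpos hδ.le (hδle.trans hδ₀1)
      exact mul_nonneg (by positivity) (by linarith)
    linarith
  · obtain ⟨k, hk1, hk2⟩ := exists_nat_pow_near_of_lt_one (div_pos hδ hδ₀)
      ((div_le_one hδ₀).2 hδle) (one_half_pos (α := ℝ)) one_half_lt_one
    rw [lt_div_iff₀ hδ₀, mul_comm] at hk1
    rw [div_le_iff₀ hδ₀, mul_comm] at hk2
    have hk : k₀ ≤ k := by
      by_contra hlt
      have h3 : (1 / 2 : ℝ) ^ (k₀ + 1) ≤ (1 / 2) ^ (k + 1) :=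
        pow_le_pow_of_le_one (by norm_num) (by norm_num) (by omega)
      have h4 := mul_le_mul_of_nonneg_left h3 hδ₀.le
      linarith [hδ₂.2]
    obtain ⟨n, h1, h2, h3⟩ := hk₀ k hk
    set ρ := δ₀ * (1 / 2 : ℝ) ^ k with hρ
    have hρ2 : ρ ≤ 2 * δ := by
      rw [pow_succ, ← mul_assoc, ← hρ] at hk1; linarith
    have hρ0 : 0 < ρ := hδ.trans_le hk2
    obtain ⟨e1, e2, e3⟩ := hscale n ρ hρ0 h1 h2
    have e4 := hlb n (hlarge n ρ (by linarith [hδ₁.2]) h1) _ e3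
    have hlogρ := Real.log_le_log hδ hk2
    have hlogρ2 := Real.log_le_log hρ0 hρ2
    rw [Real.log_mul two_ne_zero hδ.ne'] at hlogρ2
    have hposball : 0 < μ.real (Metric.closedBall x δ) := by
      obtain ⟨n', h1', -⟩ := hE.exists_word_scale hC hδ (hδle.trans hδ₀C) hxA
      exact (hμ.measureReal_pos hE _).trans_le
        (hE.measureReal_le_closedBall (hE.mem_word hxA n') h1')
    have e5 := Real.log_le_log hposball
      (measureReal_mono (μ := μ) (Metric.closedBall_subset_closedBall (x := x) hk2))
    have e6 : s * d n ≤ s * (Real.log 2 + Real.log δ) := by gcongr; linarith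
    have e7 := (abs_le.1 e4).2
    have hρneg : 0 ≤ -Real.log ρ := by
      have : ρ ≤ 1 := (mul_le_of_le_one_right hδ₀.le
        (pow_le_one₀ (by norm_num) (by norm_num))).trans hδ₀1
      linarith [Real.log_nonpos hρ0.le this]
    have e8 : 1 / (j + 1 : ℝ) * -Real.log ρ ≤ ε / 2 * -Real.log δ :=
      mul_le_mul hj.le (by linarith) hρneg (by positivity)
    have e9 : ε / 2 * (K + Real.log C - Real.log ρ) ≤ ε / 2 * (K + Real.log C - Real.log δ) := by
      gcongr
    have e10 : 0 ≤ s * Real.log C := by positivity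
    change Real.log (μ.real (Metric.closedBall x ρ)) ≤ a n + 1 / (j + 1 : ℝ) * -Real.log ρ at h3
    linarith

/-! ### The entropy dimension -/

/-- The entropy dimension follows from the local dimension by dominated convergence. -/
theorem HasLimitWeights.hasEntropyDim (hX : IsDoubling X)
    (hE : IsMoranConstruction E r) (hμ : HasLimitWeights μ E p) {x : X} (hx : x ∈ limitSet E) :
    HasEntropyDim μ x
      (((∑ i, p i x * Real.log (p i x)) / ∑ i, p i x * Real.log (r i x) : ℝ) : EReal) := by
  obtain ⟨C, hC1, hC⟩ := hE.exists_diam_le_mul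
  have hC0 : 0 < C := one_pos.trans_le hC1
  obtain ⟨b, hb, K, hK, hlen⟩ := hE.exists_log_diam_le
  obtain ⟨C₂, hC₂, hmass⟩ := hμ.exists_le_log_measureReal hE
  have hlogC : 0 ≤ Real.log C := Real.log_nonneg hC1
  set s : X → ℝ := fun y => (∑ i, p i y * Real.log (p i y)) / ∑ i, p i y * Real.log (r i y) with hs
  set F : ℝ → X → ℝ := fun δ y => Real.log (μ.real (Metric.closedBall y δ)) / Real.log δ with hF
  have hscont : ContinuousOn s (limitSet E) := by
    refine ContinuousOn.div
      (continuousOn_finsetSum _ fun i _ => (hμ.continuousOn i).mul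
        ((hμ.continuousOn i).log fun y hy => (hμ.mem_Ioo i y hy).1.ne'))
      (continuousOn_finsetSum _ fun i _ => (hμ.continuousOn i).mul
        ((hE.ratio_continuous i).log fun y hy => (hE.ratio_mem i y hy).1.ne')) fun y hy => ?_
    exact (Finset.sum_neg (fun i _ => mul_neg_of_pos_of_neg (hμ.mem_Ioo i y hy).1
      (Real.log_neg (hE.ratio_mem i y hy).1 (hE.ratio_mem i y hy).2)) Finset.univ_nonempty).ne
  have hFmeas : ∀ δ, Measurable (F δ) := fun δ => by
    have h1 : MeasurableSet {z : X × X | dist z.2 z.1 ≤ δ} :=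
      (isClosed_le (by fun_prop) continuous_const).measurableSet
    have h2 : Measurable fun y => μ (Metric.closedBall y δ) := measurable_measure_prodMk_left h1
    exact (Real.measurable_log.comp h2.ennreal_toReal).div_const _
  set D := C₂ * ((K + Real.log C + 1) / b + 1) with hD
  have hbound : ∀ᶠ δ : ℝ in 𝓝[>] 0, ∀ y ∈ limitSet E, ‖F δ y‖ ≤ D := by
    have hev : ∀ᶠ δ : ℝ in 𝓝[>] 0, δ ∈ Ioo 0 (min (Real.exp (-1)) (C * Metric.diam (E []))) :=
      Ioo_mem_nhdsGT (lt_min (Real.exp_pos _) (mul_pos hC0 (hE.diam_pos [])))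
    filter_upwards [hev] with δ hδ y hy
    obtain ⟨n, h1, h2⟩ := hE.exists_word_scale hC hδ.1 (hδ.2.le.trans (min_le_right _ _)) hy
    have hpos := hE.diam_pos (word E y n)
    have hlog : Real.log δ ≤ -1 := by
      have := Real.log_le_log hδ.1 (hδ.2.le.trans (min_le_left _ _))
      rwa [Real.log_exp] at this
    have h3 := Real.log_le_log hδ.1 h2
    rw [Real.log_mul hC0.ne' hpos.ne'] at h3
    have h4 := hlen (word E y n)
    have h5 := hmass (word E y n)
    rw [length_word] at h4 h5
    have h6 := Real.log_le_log (hμ.measureReal_pos hE _)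
      (hE.measureReal_le_closedBall (μ := μ) (hE.mem_word hy n) h1)
    have h7 : Real.log (μ.real (Metric.closedBall y δ)) ≤ 0 :=
      Real.log_nonpos measureReal_nonneg measureReal_le_one
    have hL : 1 ≤ -Real.log δ := by linarith
    have h8 : (n : ℝ) + 1 ≤ ((K + Real.log C + 1) / b + 1) * -Real.log δ := by
      have h9 : (n : ℝ) ≤ (K + Real.log C + -Real.log δ) / b := by
        rw [le_div_iff₀ hb]; linarith
      have h10 : (K + Real.log C + -Real.log δ) / b
          ≤ (K + Real.log C + 1) / b * -Real.log δ := by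
        rw [div_mul_eq_mul_div]
        gcongr
        have : (K + Real.log C) * 1 ≤ (K + Real.log C) * -Real.log δ := by gcongr
        linarith
      linarith
    rw [hF, Real.norm_eq_abs, abs_div, abs_of_nonpos h7, abs_of_neg (by linarith),
      div_le_iff₀ (by linarith)]
    have h11 := mul_le_mul_of_nonneg_left h8 hC₂
    rw [hD]
    linarith
  -- On a fixed ball the quotients of the local dimension are bounded and converge a.e.
  have hinner : ∀ ρ : ℝ, Tendsto (fun δ => entropyQuotient μ x ρ δ) (𝓝[>] 0)
      (𝓝 (⨍ y in Metric.closedBall x ρ, s y ∂μ)) := fun ρ => by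
    have h1 : Tendsto (fun δ => ∫ y in Metric.closedBall x ρ, F δ y ∂μ) (𝓝[>] 0)
        (𝓝 (∫ y in Metric.closedBall x ρ, s y ∂μ)) := by
      refine tendsto_integral_filter_of_dominated_convergence (fun _ => D)
        (.of_forall fun δ => (hFmeas δ).aestronglyMeasurable) ?_ (integrable_const D) ?_
      · filter_upwards [hbound] with δ hδ
        exact ae_restrict_of_ae (hμ.ae_mem.mono hδ)
      · exact ae_restrict_of_ae (hμ.ae_tendsto_log_closedBall_div hX hE)
    have h2 := h1.const_mul (μ.real (Metric.closedBall x ρ))⁻¹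
    rw [setAverage_eq, smul_eq_mul]
    refine h2.congr fun δ => ?_
    rw [entropyQuotient, setAverage_eq, smul_eq_mul, hF, integral_div, mul_div_assoc]
  -- The mean of the continuous function `s` over a shrinking ball tends to its value at the centre.
  have houter : Tendsto (fun ρ => ⨍ y in Metric.closedBall x ρ, s y ∂μ) (𝓝[>] 0) (𝓝 (s x)) := by
    rw [Metric.tendsto_nhds]
    intro ε hε
    obtain ⟨ρ₀, hρ₀, h⟩ := Metric.continuousOn_iff.1 hscont x hx (ε / 2) (half_pos hε)
    filter_upwards [Ioo_mem_nhdsGT hρ₀] with ρ hρ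
    have h1 : 0 < μ (Metric.closedBall x ρ) := (Measure.mem_support_iff_forall x).1
      (hμ.support_eq ▸ hx) _ (Metric.closedBall_mem_nhds x hρ.1)
    have hint : IntegrableOn s (Metric.closedBall x ρ) μ := by
      have h2 := hscont.integrableOn_compact hE.isCompact_limitSet (μ := μ)
      rw [IntegrableOn, Measure.restrict_eq_self_of_ae_mem hμ.ae_mem] at h2
      exact h2.integrableOn
    have h3 : ∀ᵐ y ∂μ.restrict (Metric.closedBall x ρ), s y ∈ Metric.closedBall (s x) (ε / 2) := by
      filter_upwards [ae_restrict_of_ae hμ.ae_mem,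
        ae_restrict_mem (Metric.isClosed_closedBall (x := x) (ε := ρ)).measurableSet] with y hy hyx
      exact (h y hy (lt_of_le_of_lt hyx hρ.2)).le
    have h4 := (convex_closedBall (s x) (ε / 2)).set_average_mem Metric.isClosed_closedBall h1.ne'
      (measure_ne_top _ _) h3 hint
    exact lt_of_le_of_lt h4 (half_lt_self hε)
  have hcoe : Tendsto (fun ρ => ((⨍ y in Metric.closedBall x ρ, s y ∂μ : ℝ) : EReal)) (𝓝[>] 0)
      (𝓝 (s x : EReal)) := (continuous_coe_real_ereal.tendsto _).comp houter
  have hin : ∀ ρ, Tendsto (fun δ => (entropyQuotient μ x ρ δ : EReal)) (𝓝[>] 0)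
      (𝓝 ((⨍ y in Metric.closedBall x ρ, s y ∂μ : ℝ) : EReal)) := fun ρ =>
    (continuous_coe_real_ereal.tendsto _).comp (hinner ρ)
  constructor
  · rw [lowerEntropyDim]
    simp only [fun ρ => (hin ρ).liminf_eq]
    exact hcoe.liminf_eq
  · rw [upperEntropyDim]
    simp only [fun ρ => (hin ρ).limsup_eq]
    exact hcoe.limsup_eq

end LocalDimension

end LocalDim

end

theorem mainTheorem8 {X : Type*} [MetricSpace X] [CompleteSpace X] [MeasurableSpace X]
    [BorelSpace X] (hX : LocalDim.IsDoubling X)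
    {m : ℕ} (E : List (Fin m) → Set X) (r : Fin m → X → ℝ)
    (hE : LocalDim.IsMoranConstruction E r)
    (μ : Measure X) [IsProbabilityMeasure μ] (hμ : μ.support = LocalDim.limitSet E)
    (p : Fin m → X → ℝ)
    (hp_cont : ∀ i, ContinuousOn (p i) (LocalDim.limitSet E))
    (hp_mem : ∀ i, ∀ x ∈ LocalDim.limitSet E, p i x ∈ Ioo (0 : ℝ) 1)
    (hp_sum : ∀ x ∈ LocalDim.limitSet E, ∑ i, p i x = 1)
    (hp_lower : ∃ a : ℝ, 0 < a ∧ ∀ i, ∀ x ∈ LocalDim.limitSet E, a < p i x)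
    (hp_lim : ∀ i, TendstoUniformlyOn
      (fun n (z : (ℕ → Fin m) × X) => LocalDim.weight μ E (LocalDim.pref z.1 n) i)
      (fun z => p i z.2) atTop (LocalDim.coding E)) :
    (∀ x ∈ LocalDim.limitSet E, ∀ q : ℝ, 0 ≤ q →
      ∃ τ : ℝ, LocalDim.lqSpectrum μ q x = (τ : EReal) ∧
        ∑ i, p i x ^ q * r i x ^ (-τ) = 1 ∧
        ∀ τ' : ℝ, ∑ i, p i x ^ q * r i x ^ (-τ') = 1 → τ' = τ) ∧
    (∀ᵐ x ∂μ,
      LocalDim.HasEntropyDim μ x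
        (((∑ i, p i x * Real.log (p i x)) / ∑ i, p i x * Real.log (r i x) : ℝ) : EReal) ∧
      LocalDim.HasLocalDim μ x
        (((∑ i, p i x * Real.log (p i x)) / ∑ i, p i x * Real.log (r i x) : ℝ) : EReal)) := by
  have hw : LocalDim.HasLimitWeights μ E p := ⟨hμ, hp_cont, hp_mem, hp_sum, hp_lower, hp_lim⟩
  have := hX.properSpace
  have := hw.nontrivial
  refine ⟨fun x hx q hq => ?_, ?_⟩
  · obtain ⟨τ, hτ, huniq⟩ := LocalDim.existsUnique_sum_mul_rpow_eq_one
      (fun i => Real.rpow_pos_of_pos (hp_mem i x hx).1 q) fun i => hE.ratio_mem i x hx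
    exact ⟨τ, hw.lqSpectrum_eq hX hE hq hx hτ, hτ, huniq⟩
  · filter_upwards [hw.ae_mem, hw.ae_tendsto_log_closedBall_div hX hE] with x hx hlim
    exact ⟨hw.hasEntropyDim hX hE hx, hw.hasLocalDim_of_tendsto hx hlim⟩
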